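/- Let $d\ge 2$, $n\ge 0$, and let $(M_t,\mathcal F_t)_{t=0}^n$ be a square-integrable martingale in $\mathbb R^d$ with $M_0=0$ and increments $\xi_t=M_t-M_{t-1}$. Put $\Sigma_t=\mathbb E[\xi_t\xi_t'\mid\mathcal F_{t-1}]$ and $V_n=\sum_{t=1}^n\Sigma_t$. Let $N_1,\dots,N_n$ be i.i.d. standard Gaussian vectors in $\mathbb R^d$, independent of $\mathcal F_n$, and let $\eta_t=\Sigma_t^{1/2}N_t$, where $\Sigma_t^{1/2}$ is any $\mathcal F_{t-1}$-measurable random $d\times d$ matrix with $\Sigma_t^{1/2}(\Sigma_t^{1/2})'=\Sigma_t$ a.s. Write $\|\cdot\|_\infty$ for the sup norm of vectors and the entrywise sup norm of matrices, and $\preceq$ for the positive semidefinite order. Suppose that $V$ and $V_\delta$ are deterministic symmetric positive semidefinite $d\times d$ matrices and $\alpha\in\mathbb R$ with $$P(V_n\preceq V+V_\delta)\ge 1-\alpha,\qquad\text{and put}\qquad \Delta_n=\|V_\delta\|_\infty+\mathbb E\|V-V_n\|_\infty .$$ Let $H\sim N(0,V)$. Let $W_n$ be a random positive semidefinite $d\times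 d$ matrix (possibly dependent on all other randomness), and let $H_n$ be a random vector that, conditionally on a $\sigma$-algebra with respect to which $W_n$ is measurable (for instance the one generated by all the other random variables), is Gaussian with mean $0$ and covariance $W_n$. Let $$Z=\max_{j\le d}\sum_{t=1}^n\xi_{t,j},\qquad \widetilde Z=\max_{j\le d}H_j,\qquad \widetilde Z_n=\max_{j\le d}H_{n,j},$$ and for $A\subset\mathbb R$ let $A^{\varepsilon}=\{x:\operatorname{dist}(x,A)\le\varepsilon\}$ (with $\emptyset^\varepsilon=\emptyset$). There is a universal constant $C>0$ such that, in every such situation, for every $\bar\delta>0$ and every Borel set $A\subset\mathbb R$, $$P(Z\in A)\le P(\widetilde Z\in A^{C\bar\delta})+a_n(\bar\delta)$$ and, almost surely, $$P(Z\in A)\le P(\widetilde Z_n\in A^{C\bar\delta}\mid W_n)+\frac{C\log d}{\bar\delta^2}\,\|V-W_n\|_\infty+a_n(\bar\delta),$$ where $$a_n(\bar\delta)=2\alpha+\frac{C\log d}{\bar\delta^2}\,\Delta_n+\frac{C\log^2 d}{\bar\delta^3}\sum_{t=1}^n\mathbb E\left(\|\xi_t\|_\infty^3+\|\eta_t\|_\infty^3\right)\in[0,\infty].$$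 -/

import Mathlib

open MeasureTheory ProbabilityTheory
open scoped ENNReal

namespace MaxCLT

noncomputable section

/-- The increment `ξ_t = M_t - M_{t-1}`. The index `t : Fin n` stands for the time `t + 1`, so that
`t.castSucc` is the time just before it. -/
def increment {Ω : Type*} {n d : ℕ} (M : Fin (n + 1) → Ω → Fin d → ℝ) (t : Fin n) (ω : Ω) :
    Fin d → ℝ :=
  M t.succ ω - M t.castSucc ω

/-- The conditional covariance `Σ_t = E[ξ_t ξ_t' | ℱ_{t-1}]`, computed entry by entry. -/
def condCov {Ω : Type*} {mΩ : MeasurableSpace Ω} {n d : ℕ} (P : Measure Ω)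
    (ℱ : Filtration (Fin (n + 1)) mΩ) (M : Fin (n + 1) → Ω → Fin d → ℝ) (t : Fin n) (ω : Ω) :
    Matrix (Fin d) (Fin d) ℝ :=
  Matrix.of fun i j =>
    (P[fun ω' => increment M t ω' i * increment M t ω' j | ℱ t.castSucc]) ω

/-- The quadratic variation `V_n = ∑ₜ Σ_t`. -/
def quadVar {Ω : Type*} {mΩ : MeasurableSpace Ω} {n d : ℕ} (P : Measure Ω)
    (ℱ : Filtration (Fin (n + 1)) mΩ) (M : Fin (n + 1) → Ω → Fin d → ℝ) (ω : Ω) :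
    Matrix (Fin d) (Fin d) ℝ :=
  ∑ t : Fin n, condCov P ℱ M t ω

/-- The entrywise `ℓ^∞` norm of a matrix (the sup norm on functions of two indices). -/
def entryNorm {d : ℕ} (B : Matrix (Fin d) (Fin d) ℝ) : ℝ :=
  ‖(fun i j => B i j : Fin d → Fin d → ℝ)‖

/-- The maximum of the coordinates of a vector. -/
def maxCoord {d : ℕ} (x : Fin d → ℝ) : ℝ := ⨆ j, x j

/-- `(M_t, ℱ_t)`, `0 ≤ t ≤ n`, is a square integrable martingale in `ℝ^d` that starts at `0`. -/
structure IsMartingaleFromZero {Ω : Type*} {mΩ : MeasurableSpace Ω} {n d : ℕ} (P : Measure Ω)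
    (ℱ : Filtration (Fin (n + 1)) mΩ) (M : Fin (n + 1) → Ω → Fin d → ℝ) : Prop where
  martingale : Martingale M ℱ P
  start : M 0 =ᵐ[P] 0
  memLp_two : ∀ t, MemLp (M t) 2 P

/-- `N_1, …, N_n` are i.i.d. standard Gaussian vectors in `ℝ^d`, jointly independent of the
`σ`-algebra `m`. -/
structure IsStdGaussianNoise {Ω : Type*} (m : MeasurableSpace Ω) {mΩ : MeasurableSpace Ω}
    {n d : ℕ} (P : Measure Ω) (N : Fin n → Ω → Fin d → ℝ) : Prop where
  measurable : ∀ t, Measurable[mΩ] (N t)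
  map_eq : ∀ t, P.map (N t) = Measure.pi fun _ => gaussianReal 0 1
  iIndep : iIndepFun N P
  indep : Indep (MeasurableSpace.comap (fun ω t => N t ω) MeasurableSpace.pi) m P

/-- `S_t` is a version of `Σ_t^{1/2}`: an `ℱ_{t-1}`-measurable random matrix such that
`S_t S_t' = Σ_t`. -/
structure IsSqrtCondCov {Ω : Type*} {mΩ : MeasurableSpace Ω} {n d : ℕ} (P : Measure Ω)
    (ℱ : Filtration (Fin (n + 1)) mΩ) (M : Fin (n + 1) → Ω → Fin d → ℝ)
    (S : Fin n → Ω → Matrix (Fin d) (Fin d) ℝ) : Prop where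
  measurable : ∀ t i j, Measurable[ℱ t.castSucc] fun ω => S t ω i j
  mul_transpose : ∀ t, ∀ᵐ ω ∂P, S t ω * (S t ω).transpose = condCov P ℱ M t ω

/-- The Gaussian-type increment `η_t = Σ_t^{1/2} N_t`. -/
def gaussIncrement {Ω : Type*} {n d : ℕ} (S : Fin n → Ω → Matrix (Fin d) (Fin d) ℝ)
    (N : Fin n → Ω → Fin d → ℝ) (t : Fin n) (ω : Ω) : Fin d → ℝ :=
  (S t ω).mulVec (N t ω)

/-- `Δ_n = ‖V_δ‖_∞ + E ‖V - V_n‖_∞`. -/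
def deltaN {Ω : Type*} {mΩ : MeasurableSpace Ω} {n d : ℕ} (P : Measure Ω)
    (ℱ : Filtration (Fin (n + 1)) mΩ) (M : Fin (n + 1) → Ω → Fin d → ℝ)
    (V Vδ : Matrix (Fin d) (Fin d) ℝ) : ℝ :=
  entryNorm Vδ + ∫ ω, entryNorm (V - quadVar P ℱ M ω) ∂P

/-- `∑ₜ E (‖ξ_t‖_∞³ + ‖η_t‖_∞³)`, which may be infinite. The norm of `Fin d → ℝ` is the sup
norm. -/
def thirdMoments {Ω : Type*} {mΩ : MeasurableSpace Ω} {n d : ℕ} (P : Measure Ω)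
    (ξ η : Fin n → Ω → Fin d → ℝ) : ℝ≥0∞ :=
  ∑ t : Fin n, ∫⁻ ω, (‖ξ t ω‖ₑ ^ 3 + ‖η t ω‖ₑ ^ 3) ∂P

/-- The error term
`a_n(δ) = 2 α + C (log d) δ⁻² Δ + C (log d)² δ⁻³ T`, where `T` may be infinite. -/
def errorTerm (C : ℝ) (d : ℕ) (α Δ : ℝ) (T : ℝ≥0∞) (δ : ℝ) : ℝ≥0∞ :=
  ENNReal.ofReal (2 * α) + ENNReal.ofReal (C * Real.log d / δ ^ 2 * Δ)
    + ENNReal.ofReal (C * Real.log d ^ 2 / δ ^ 3) * T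

/-- The `σ`-algebra generated by a random matrix. -/
abbrev sigmaOf {Ω : Type*} {d : ℕ} (W : Ω → Matrix (Fin d) (Fin d) ℝ) : MeasurableSpace Ω :=
  MeasurableSpace.comap (fun ω (i j : Fin d) => W ω i j) MeasurableSpace.pi

/-- Conditionally on the `σ`-algebra `𝒢`, with respect to which the random positive semidefinite
matrix `W` is measurable, the random vector `X` is Gaussian with mean `0` and covariance `W`. -/
structure IsCondGaussian {Ω : Type*} (𝒢 : MeasurableSpace Ω) {mΩ : MeasurableSpace Ω} {d : ℕ}
    (P : Measure Ω) (W : Ω → Matrix (Fin d) (Fin d) ℝ) (X : Ω → EuclideanSpace ℝ (Fin d)) :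
    Prop where
  le : 𝒢 ≤ mΩ
  measurable_cov : ∀ i j, Measurable[𝒢] fun ω => W ω i j
  posSemidef : ∀ᵐ ω ∂P, (W ω).PosSemidef
  measurable : Measurable[mΩ] X
  condLaw : ∀ B : Set (EuclideanSpace ℝ (Fin d)), MeasurableSet B →
    P⟦X ⁻¹' B | 𝒢⟧ =ᵐ[P] fun ω => (multivariateGaussian 0 (W ω)).real B

end

end MaxCLT

/-! The proof is Lindeberg's replacement argument with a reserve of covariance. The indicator of
`maxCoord x ∈ A` lies below a smooth function `f`, a cutoff composed with the smooth maximum at `β =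
log d / δ` (`exists_hasTaylor_cutoff`). Directional derivatives of the smooth maximum are
polynomials in moments under probability weights, so the dimension enters only through `β`: the
quadratic Taylor coefficients have `ℓ¹` norm `K₂ ≲ log d / δ²`, and the cubic remainder has constant
`K₃ ≲ log² d / δ³`.

The averages `gaussAvg Q f` form a semigroup in `Q` and inherit both Taylor constants. Start at the
point `0` with reserve `V + Vδ`. At each time, if `Σ_t` can be taken from the reserve leaving a
positive semidefinite matrix, take it and add `ξ_t` to the point; otherwise skip both. The new
reserve is already known at time `t - 1`, so conditionally on the past `ξ_t` meets a fixed smooth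
function and can be exchanged with `N(0, Σ_t)`. The first two moments agree, so only third moments
are paid (`HasTaylor.setIntegral_gaussAvg_add_le`, summed in
`HasTaylor.integral_gaussAvg_thinnedSum_le`). The Gaussians are integrated out throughout; the
vectors `N_t` serve only to identify the third moments of `η_t`.

If `V_n ≼ V + Vδ`, nothing is skipped: the point ends at the full sum of increments and the reserve
at `V + Vδ - V_n`. By Gaussian comparison (`HasTaylor.abs_gaussAvg_sub_gaussAvg_le`), dropping this
reserve costs `K₂ (‖Vδ‖ + ‖V - V_n‖)`. The complementary event costs at most `α`, and passing from
`V + Vδ` to `V` costs `K₂ ‖Vδ‖` once more. This gives `HasTaylor.measureReal_maxCoord_le`. The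
bootstrap bound follows by comparing `V` with `W_n` in the same way. -/

namespace MaxCLT

noncomputable section

open Filter Topology Matrix

/-! ### Centered Gaussian measures and Gaussian averages. -/

section

variable {d : ℕ}

/-- The centered Gaussian measure with covariance `Q`, on functions with the sup norm. -/
def centeredGaussian (Q : Matrix (Fin d) (Fin d) ℝ) : Measure (Fin d → ℝ) :=
  (multivariateGaussian 0 Q).map (WithLp.ofLp : EuclideanSpace ℝ (Fin d) → Fin d → ℝ)

lemma measurable_ofLp_euclidean :
    Measurable (WithLp.ofLp : EuclideanSpace ℝ (Fin d) → Fin d → ℝ) := by fun_prop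

instance (Q : Matrix (Fin d) (Fin d) ℝ) : IsProbabilityMeasure (centeredGaussian Q) :=
  Measure.isProbabilityMeasure_map measurable_ofLp_euclidean.aemeasurable

instance (Q : Matrix (Fin d) (Fin d) ℝ) : IsGaussian (centeredGaussian Q) := by
  have : IsGaussian ((multivariateGaussian 0 Q).map
    (EuclideanSpace.equiv (Fin d) ℝ : EuclideanSpace ℝ (Fin d) →L[ℝ] Fin d → ℝ)) := inferInstance
  exact this

lemma integral_centeredGaussian (Q : Matrix (Fin d) (Fin d) ℝ) {f : (Fin d → ℝ) → ℝ}
    (hf : Measurable f) :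
    ∫ y, f y ∂centeredGaussian Q = ∫ y, f (WithLp.ofLp y) ∂multivariateGaussian 0 Q := by
  rw [centeredGaussian, integral_map measurable_ofLp_euclidean.aemeasurable
    hf.aestronglyMeasurable]

lemma integrable_norm_pow_three_centeredGaussian (Q : Matrix (Fin d) (Fin d) ℝ) :
    Integrable (fun y => ‖y‖ ^ 3) (centeredGaussian Q) :=
  MemLp.integrable_norm_pow (p := 3) (f := fun y => y)
    (IsGaussian.memLp_id (centeredGaussian Q) 3 (by norm_num)) (by norm_num)

lemma memLp_eval_centeredGaussian (Q : Matrix (Fin d) (Fin d) ℝ) (i : Fin d) :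
    MemLp (fun y : Fin d → ℝ => y i) 2 (centeredGaussian Q) :=
  IsGaussian.memLp_dual (centeredGaussian Q)
    (ContinuousLinearMap.proj (R := ℝ) (φ := fun _ : Fin d => ℝ) i) 2 (by norm_num)

lemma integrable_eval_centeredGaussian (Q : Matrix (Fin d) (Fin d) ℝ) (i : Fin d) :
    Integrable (fun y : Fin d → ℝ => y i) (centeredGaussian Q) :=
  (memLp_eval_centeredGaussian Q i).integrable (by norm_num)

lemma integrable_eval_mul_eval_centeredGaussian (Q : Matrix (Fin d) (Fin d) ℝ) (i j : Fin d) :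
    Integrable (fun y : Fin d → ℝ => y i * y j) (centeredGaussian Q) :=
  (memLp_eval_centeredGaussian Q i).integrable_mul (memLp_eval_centeredGaussian Q j)

lemma integral_eval_multivariateGaussian (Q : Matrix (Fin d) (Fin d) ℝ) (i : Fin d) :
    ∫ y, y i ∂(multivariateGaussian 0 Q : Measure (EuclideanSpace ℝ (Fin d))) = 0 := by
  have h := (EuclideanSpace.proj (𝕜 := ℝ) i).integral_comp_id_comm
    (IsGaussian.integrable_id (μ := multivariateGaussian 0 Q))
  simp only [integral_id_multivariateGaussian, map_zero] at h
  exact h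

lemma integral_eval_centeredGaussian (Q : Matrix (Fin d) (Fin d) ℝ) (i : Fin d) :
    ∫ y, y i ∂centeredGaussian Q = 0 := by
  rw [integral_centeredGaussian Q (by fun_prop)]
  exact integral_eval_multivariateGaussian Q i

lemma integral_eval_mul_eval_centeredGaussian {Q : Matrix (Fin d) (Fin d) ℝ} (hQ : Q.PosSemidef)
    (i j : Fin d) : ∫ y, y i * y j ∂centeredGaussian Q = Q i j := by
  rw [integral_centeredGaussian Q (by fun_prop)]
  have h := covariance_eval_multivariateGaussian (μ := 0) hQ i j
  simp only [covariance, integral_eval_multivariateGaussian, sub_zero] at h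
  exact h

/-- Moving `S` to the other side of the inner product evaluates the standard Gaussian characteristic
function at `Sᵀ t`, and `‖Sᵀ t‖² = t ⬝ S Sᵀ t`. -/
lemma charFun_map_toEuclideanCLM (S : Matrix (Fin d) (Fin d) ℝ) (t : EuclideanSpace ℝ (Fin d)) :
    charFun ((stdGaussian (EuclideanSpace ℝ (Fin d))).map (toEuclideanCLM (𝕜 := ℝ) S)) t =
      charFun (multivariateGaussian 0 (S * Sᵀ)) t := by
  have hS : (S * Sᵀ).PosSemidef := by
    simpa [conjTranspose_eq_transpose_of_trivial] using posSemidef_self_mul_conjTranspose S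
  rw [charFun_multivariateGaussian hS, charFun_apply, integral_map (by fun_prop)
    (Measurable.aestronglyMeasurable (by fun_prop))]
  simp_rw [← ContinuousLinearMap.adjoint_inner_right]
  rw [← charFun_apply, charFun_stdGaussian, ← ContinuousLinearMap.star_eq_adjoint, ← map_star,
    ← Complex.ofReal_pow, ← real_inner_self_eq_norm_sq]
  congr 1
  have : inner ℝ ((toEuclideanCLM (𝕜 := ℝ) (star S)) t) ((toEuclideanCLM (𝕜 := ℝ) (star S)) t)
      = t.ofLp ⬝ᵥ (S * Sᵀ) *ᵥ t.ofLp := by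
    conv_lhs => enter [2]; rw [map_star, ContinuousLinearMap.star_eq_adjoint]
    rw [ContinuousLinearMap.adjoint_inner_left, ← ContinuousLinearMap.comp_apply,
      ← ContinuousLinearMap.mul_def, ← map_mul, inner_toEuclideanCLM,
      star_eq_conjTranspose, conjTranspose_eq_transpose_of_trivial]
  rw [this]
  simp [neg_div]

/-- The image of the standard Gaussian measure under `S` has covariance `S Sᵀ`. -/
lemma map_mulVec_pi_gaussianReal (S : Matrix (Fin d) (Fin d) ℝ) :
    (Measure.pi fun _ => gaussianReal 0 1).map S.mulVec = centeredGaussian (S * Sᵀ) := by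
  have h : (stdGaussian (EuclideanSpace ℝ (Fin d))).map (toEuclideanCLM (𝕜 := ℝ) S) =
      multivariateGaussian 0 (S * Sᵀ) :=
    Measure.ext_of_charFun (funext fun t => charFun_map_toEuclideanCLM S t)
  rw [centeredGaussian, ← h, ← map_pi_eq_stdGaussian, Measure.map_map (by fun_prop) (by fun_prop),
    Measure.map_map (by fun_prop) (by fun_prop)]
  congr 1

lemma multivariateGaussian_conv {Q R : Matrix (Fin d) (Fin d) ℝ} (hQ : Q.PosSemidef)
    (hR : R.PosSemidef) :
    multivariateGaussian 0 Q ∗ multivariateGaussian 0 R = multivariateGaussian 0 (Q + R) := by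
  apply Measure.ext_of_charFun
  ext t
  rw [charFun_conv, charFun_multivariateGaussian hQ, charFun_multivariateGaussian hR,
    charFun_multivariateGaussian (hQ.add hR), ← Complex.exp_add]
  simp only [add_mulVec, dotProduct_add, inner_zero_right, Complex.ofReal_zero, zero_mul,
    Complex.ofReal_add]
  congr 1
  ring

lemma multivariateGaussian_sq_smul (c : ℝ) {Q : Matrix (Fin d) (Fin d) ℝ} (hQ : Q.PosSemidef) :
    multivariateGaussian 0 (c ^ 2 • Q) =
      (multivariateGaussian 0 Q).map fun x : EuclideanSpace ℝ (Fin d) => c • x := by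
  apply Measure.ext_of_charFun
  ext t
  rw [charFun_map_smul, charFun_multivariateGaussian hQ,
    charFun_multivariateGaussian (hQ.smul (sq_nonneg c))]
  simp only [inner_zero_right, WithLp.ofLp_smul, mulVec_smul, smul_mulVec, dotProduct_smul,
    smul_dotProduct, smul_eq_mul]
  congr 4
  ring

/-- `gaussAvg Q f x = E f (x + Y)` with `Y ∼ N(0, Q)`. -/
def gaussAvg (Q : Matrix (Fin d) (Fin d) ℝ) (f : (Fin d → ℝ) → ℝ) (x : Fin d → ℝ) : ℝ :=
  ∫ y, f (x + y) ∂centeredGaussian Q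

lemma integrable_comp_add_centeredGaussian (Q : Matrix (Fin d) (Fin d) ℝ) {f : (Fin d → ℝ) → ℝ}
    (hf : Continuous f) {B : ℝ} (hB : ∀ x, |f x| ≤ B) (x : Fin d → ℝ) :
    Integrable (fun y => f (x + y)) (centeredGaussian Q) :=
  Integrable.of_bound (by fun_prop : Continuous fun y => f (x + y)).aestronglyMeasurable B
    (ae_of_all _ fun y => hB _)

lemma integral_norm_pow_three_sq_smul (c : ℝ) {Q : Matrix (Fin d) (Fin d) ℝ} (hQ : Q.PosSemidef) :
    ∫ y, ‖y‖ ^ 3 ∂centeredGaussian (c ^ 2 • Q) = |c| ^ 3 * ∫ y, ‖y‖ ^ 3 ∂centeredGaussian Q := by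
  rw [integral_centeredGaussian _ (by fun_prop), multivariateGaussian_sq_smul c hQ,
    integral_map (by fun_prop) (Measurable.aestronglyMeasurable (by fun_prop)),
    integral_centeredGaussian _ (by fun_prop), ← integral_const_mul]
  simp [norm_smul, mul_pow]

/-- Semigroup property: a sum of independent Gaussians is Gaussian with the sum of the covariances.
It lets a piece of covariance be split off and exchanged. -/
lemma gaussAvg_add {Q R : Matrix (Fin d) (Fin d) ℝ} (hQ : Q.PosSemidef) (hR : R.PosSemidef)
    {f : (Fin d → ℝ) → ℝ} (hf : Continuous f) {B : ℝ} (hB : ∀ x, |f x| ≤ B) (x : Fin d → ℝ) :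
    gaussAvg (Q + R) f x = gaussAvg Q (gaussAvg R f) x := by
  have hm : ∀ x, Measurable fun y => f (x + y) := fun x =>
    (by fun_prop : Continuous fun y => f (x + y)).measurable
  have hc : centeredGaussian (Q + R) = centeredGaussian Q ∗ centeredGaussian R := by
    rw [centeredGaussian, ← multivariateGaussian_conv hQ hR]
    exact Measure.map_conv_continuousLinearMap
      (L := (EuclideanSpace.equiv (Fin d) ℝ : EuclideanSpace ℝ (Fin d) →L[ℝ] Fin d → ℝ)) 
  rw [gaussAvg, hc, integral_conv]
  · simp only [gaussAvg, add_assoc]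
  · exact Integrable.of_bound (hm x).aestronglyMeasurable B (ae_of_all _ fun y => hB _)

/-- Moves the base point into the mean, so that joint continuity in covariance and point becomes
weak convergence of Gaussian measures. -/
lemma gaussAvg_eq_integral_multivariateGaussian (Q : Matrix (Fin d) (Fin d) ℝ)
    {f : (Fin d → ℝ) → ℝ} (hf : Continuous f) (x : Fin d → ℝ) :
    gaussAvg Q f x = ∫ y, f (WithLp.ofLp y) ∂multivariateGaussian (WithLp.toLp 2 x) Q := by
  have h : multivariateGaussian (WithLp.toLp 2 x) Q =
      (multivariateGaussian 0 Q).map fun y => WithLp.toLp 2 x + y := by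
    simp only [multivariateGaussian]
    rw [Measure.map_map (by fun_prop) (by fun_prop)]
    congr 1
    ext y
    simp
  rw [gaussAvg, integral_centeredGaussian _
    (by fun_prop : Continuous fun y => f (x + y)).measurable, h, integral_map (by fun_prop)
    (by fun_prop : Continuous fun y : EuclideanSpace ℝ (Fin d) =>
      f (WithLp.ofLp y)).aestronglyMeasurable]
  simp

/-- Lévy's continuity theorem: the characteristic function depends continuously on mean and
covariance. The explicit formula for it requires a positive semidefinite covariance, hence the
restricted domain. The purpose is measurability when the covariance is random. -/
lemma continuousOn_gaussAvg {f : (Fin d → ℝ) → ℝ} (hf : Continuous f) {B : ℝ}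
    (hB : ∀ x, |f x| ≤ B) :
    ContinuousOn (fun p : (Fin d → Fin d → ℝ) × (Fin d → ℝ) => gaussAvg (Matrix.of p.1) f p.2)
      {p | (Matrix.of p.1).PosSemidef} := by
  rw [continuousOn_iff_continuous_domRestrict, continuous_iff_seqContinuous]
  intro u p hu
  let μ : {p : (Fin d → Fin d → ℝ) × (Fin d → ℝ) // (Matrix.of p.1).PosSemidef} →
      ProbabilityMeasure (EuclideanSpace ℝ (Fin d)) := fun p =>
    ⟨multivariateGaussian (WithLp.toLp 2 p.1.2) (Matrix.of p.1.1), inferInstance⟩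
  have hμ : Tendsto (fun n => μ (u n)) atTop (𝓝 (μ p)) := by
    rw [ProbabilityMeasure.tendsto_iff_tendsto_charFun]
    intro t
    simp only [μ, ProbabilityMeasure.coe_mk]
    simp_rw [fun n => charFun_multivariateGaussian (μ := WithLp.toLp 2 (u n).1.2) (u n).2 t]
    rw [charFun_multivariateGaussian p.2 t]
    have hc : Continuous fun q : (Fin d → Fin d → ℝ) × (Fin d → ℝ) =>
        Complex.exp ((inner ℝ t (WithLp.toLp 2 q.2) : ℝ) * Complex.I -
          ((t.ofLp ⬝ᵥ Matrix.of q.1 *ᵥ t.ofLp : ℝ) : ℂ) / 2) := by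
      have : Continuous fun q : (Fin d → Fin d → ℝ) × (Fin d → ℝ) =>
          (Matrix.of q.1 : Matrix (Fin d) (Fin d) ℝ) := continuous_fst
      fun_prop
    exact ((hc.comp continuous_subtype_val).tendsto p).comp hu
  have h := ProbabilityMeasure.tendsto_iff_forall_integral_tendsto.1 hμ
    (BoundedContinuousFunction.ofNormedAddCommGroup (fun y => f (WithLp.ofLp y)) (by fun_prop) B
      fun y => hB _)
  simpa [Function.comp_def, gaussAvg_eq_integral_multivariateGaussian _ hf, μ] using h

end

/-! ### Uniform Taylor expansions and Gaussian comparison. -/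

section

variable {d : ℕ}

lemma abs_apply_le_entryNorm (B : Matrix (Fin d) (Fin d) ℝ) (i j : Fin d) :
    |B i j| ≤ entryNorm B :=
  (norm_le_pi_norm (fun j => B i j) j).trans (norm_le_pi_norm (fun i j => B i j) i)

lemma entryNorm_nonneg (B : Matrix (Fin d) (Fin d) ℝ) : 0 ≤ entryNorm B := norm_nonneg _

lemma entryNorm_add_le (A B : Matrix (Fin d) (Fin d) ℝ) :
    entryNorm (A + B) ≤ entryNorm A + entryNorm B :=
  norm_add_le (fun i j => A i j) (fun i j => B i j)

lemma entryNorm_smul (c : ℝ) (B : Matrix (Fin d) (Fin d) ℝ) :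
    entryNorm (c • B) = |c| * entryNorm B :=
  norm_smul c (fun i j => B i j)

lemma abs_sum_mul_le_entryNorm (a : Fin d → Fin d → ℝ) (B : Matrix (Fin d) (Fin d) ℝ) :
    |∑ i, ∑ j, a i j * B i j| ≤ (∑ i, ∑ j, |a i j|) * entryNorm B := by
  rw [Finset.sum_mul]
  refine (Finset.abs_sum_le_sum_abs _ _).trans (Finset.sum_le_sum fun i _ => ?_)
  rw [Finset.sum_mul]
  refine (Finset.abs_sum_le_sum_abs _ _).trans (Finset.sum_le_sum fun j _ => ?_)
  rw [abs_mul]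
  exact mul_le_mul_of_nonneg_left (abs_apply_le_entryNorm B i j) (abs_nonneg _)

/-- A bounded function `f` with a second order Taylor expansion with bounded continuous
coefficients, uniformly on `ℝ^d`: the coefficients `f₂` of the quadratic term have `ℓ¹` norm at
most `K₂`, and the remainder is at most `K₃ ‖h‖_∞³`. -/
structure HasTaylor (K₂ K₃ : ℝ) (f : (Fin d → ℝ) → ℝ) (f₁ : Fin d → (Fin d → ℝ) → ℝ)
    (f₂ : Fin d → Fin d → (Fin d → ℝ) → ℝ) : Prop where
  cont : Continuous f
  cont₁ : ∀ i, Continuous (f₁ i)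
  cont₂ : ∀ i j, Continuous (f₂ i j)
  bdd : ∃ B, ∀ x, |f x| ≤ B
  bdd₁ : ∃ B, ∀ i x, |f₁ i x| ≤ B
  bdd₂ : ∀ x, ∑ i, ∑ j, |f₂ i j x| ≤ K₂
  taylor : ∀ x h, |f (x + h) - f x - ∑ i, f₁ i x * h i - ∑ i, ∑ j, f₂ i j x * (h i * h j)| ≤
    K₃ * ‖h‖ ^ 3

lemma integral_sub_sub_sub {Ω : Type*} {mΩ : MeasurableSpace Ω} {μ : Measure Ω}
    {a b c e : Ω → ℝ} (ha : Integrable a μ) (hb : Integrable b μ) (hc : Integrable c μ)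
    (he : Integrable e μ) :
    ∫ ω, (a ω - b ω - c ω - e ω) ∂μ = ∫ ω, a ω ∂μ - ∫ ω, b ω ∂μ - ∫ ω, c ω ∂μ - ∫ ω, e ω ∂μ := by
  rw [← integral_sub ha hb, ← integral_sub (by exact ha.sub hb) hc,
    ← integral_sub (by exact (ha.sub hb).sub hc) he]

namespace HasTaylor

variable {K₂ K₃ : ℝ} {f : (Fin d → ℝ) → ℝ} {f₁ : Fin d → (Fin d → ℝ) → ℝ}
    {f₂ : Fin d → Fin d → (Fin d → ℝ) → ℝ}

lemma abs_coeff₂_le (h : HasTaylor K₂ K₃ f f₁ f₂) (i j : Fin d) (x : Fin d → ℝ) :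
    |f₂ i j x| ≤ K₂ := by
  refine le_trans ?_ (h.bdd₂ x)
  refine le_trans ?_ (Finset.single_le_sum (f := fun i => ∑ j, |f₂ i j x|)
    (fun i _ => Finset.sum_nonneg fun j _ => abs_nonneg _) (Finset.mem_univ i))
  exact Finset.single_le_sum (f := fun j => |f₂ i j x|) (fun j _ => abs_nonneg _)
    (Finset.mem_univ j)

end HasTaylor

lemma continuous_gaussAvg (Q : Matrix (Fin d) (Fin d) ℝ) {f : (Fin d → ℝ) → ℝ}
    (hf : Continuous f) {B : ℝ} (hB : ∀ x, |f x| ≤ B) : Continuous (gaussAvg Q f) :=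
  continuous_of_dominated (fun x => (by fun_prop : Continuous fun y => f (x + y)).aestronglyMeasurable)
    (fun x => ae_of_all _ fun y => hB _) (integrable_const B)
    (ae_of_all _ fun y => (by fun_prop : Continuous fun x => f (x + y)))

lemma abs_gaussAvg_le (Q : Matrix (Fin d) (Fin d) ℝ) {f : (Fin d → ℝ) → ℝ} {B : ℝ}
    (hB : ∀ x, |f x| ≤ B) (x : Fin d → ℝ) : |gaussAvg Q f x| ≤ B := by
  simpa [gaussAvg] using norm_integral_le_of_norm_le_const (μ := centeredGaussian Q)
    (f := fun y => f (x + y)) (ae_of_all _ fun y => hB (x + y))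

lemma gaussAvg_sub (Q : Matrix (Fin d) (Fin d) ℝ) {f g : (Fin d → ℝ) → ℝ}
    (hf : Continuous f) {B : ℝ} (hB : ∀ x, |f x| ≤ B)
    (hg : Continuous g) {B' : ℝ} (hB' : ∀ x, |g x| ≤ B') (x : Fin d → ℝ) :
    gaussAvg Q (fun y => f y - g y) x = gaussAvg Q f x - gaussAvg Q g x :=
  integral_sub (integrable_comp_add_centeredGaussian Q hf hB x)
    (integrable_comp_add_centeredGaussian Q hg hB' x)

namespace HasTaylor

variable {K₂ K₃ : ℝ} {f : (Fin d → ℝ) → ℝ} {f₁ : Fin d → (Fin d → ℝ) → ℝ}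
    {f₂ : Fin d → Fin d → (Fin d → ℝ) → ℝ}

/-- The hypotheses are uniform in the base point, so averaging over translates keeps both constants.
The replacement step can therefore use the same `K₃` for every random reserve. -/
lemma smoothed (h : HasTaylor K₂ K₃ f f₁ f₂) (Q : Matrix (Fin d) (Fin d) ℝ) :
    HasTaylor K₂ K₃ (gaussAvg Q f) (fun i => gaussAvg Q (f₁ i))
      (fun i j => gaussAvg Q (f₂ i j)) := by
  obtain ⟨B, hB⟩ := h.bdd
  obtain ⟨B₁, hB₁⟩ := h.bdd₁
  have hi := integrable_comp_add_centeredGaussian Q h.cont hB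
  have hi₁ := fun i => integrable_comp_add_centeredGaussian Q (h.cont₁ i) (hB₁ i)
  have hi₂ := fun i j => integrable_comp_add_centeredGaussian Q (h.cont₂ i j) (h.abs_coeff₂_le i j)
  refine ⟨continuous_gaussAvg Q h.cont hB, fun i => continuous_gaussAvg Q (h.cont₁ i) (hB₁ i),
    fun i j => continuous_gaussAvg Q (h.cont₂ i j) (h.abs_coeff₂_le i j),
    ⟨B, abs_gaussAvg_le Q hB⟩, ⟨B₁, fun i => abs_gaussAvg_le Q (hB₁ i)⟩, fun x => ?_,
    fun x v => ?_⟩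
  · calc ∑ i, ∑ j, |gaussAvg Q (f₂ i j) x|
        ≤ ∑ i, ∑ j, ∫ y, |f₂ i j (x + y)| ∂centeredGaussian Q := by
          gcongr with i _ j _
          exact abs_integral_le_integral_abs
      _ = ∫ y, ∑ i, ∑ j, |f₂ i j (x + y)| ∂centeredGaussian Q := by
          rw [integral_finsetSum _ fun i _ => integrable_finsetSum _ fun j _ => (hi₂ i j x).abs]
          congr 1 with i
          rw [integral_finsetSum _ fun j _ => (hi₂ i j x).abs]
      _ ≤ ∫ y, K₂ ∂centeredGaussian Q := by
          refine integral_mono (integrable_finsetSum _ fun i _ =>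
            integrable_finsetSum _ fun j _ => (hi₂ i j x).abs) (integrable_const _)
            fun y => h.bdd₂ _
      _ = K₂ := by simp
  · have key : gaussAvg Q f (x + v) - gaussAvg Q f x -
        ∑ i, gaussAvg Q (f₁ i) x * v i -
        ∑ i, ∑ j, gaussAvg Q (f₂ i j) x * (v i * v j) =
        ∫ y, (f (x + y + v) - f (x + y) - ∑ i, f₁ i (x + y) * v i -
          ∑ i, ∑ j, f₂ i j (x + y) * (v i * v j)) ∂centeredGaussian Q := by
      have hv : Integrable (fun y => f (x + y + v)) (centeredGaussian Q) := by
        simpa only [add_right_comm] using hi (x + v)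
      have hs₁ : Integrable (fun y => ∑ i, f₁ i (x + y) * v i) (centeredGaussian Q) :=
        integrable_finsetSum _ fun i _ => (hi₁ i x).mul_const _
      have hs₂' : ∀ i, Integrable (fun y => ∑ j, f₂ i j (x + y) * (v i * v j))
          (centeredGaussian Q) := fun i =>
        integrable_finsetSum _ fun j _ => (hi₂ i j x).mul_const _
      have hs₂ : Integrable (fun y => ∑ i, ∑ j, f₂ i j (x + y) * (v i * v j))
          (centeredGaussian Q) := integrable_finsetSum _ fun i _ => hs₂' i
      rw [integral_sub_sub_sub hv (hi x) hs₁ hs₂, integral_finsetSum _ fun i _ => (hi₁ i x).mul_const _,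
        integral_finsetSum _ fun i _ => hs₂' i]
      simp_rw [integral_finsetSum _ fun j _ => (hi₂ _ j x).mul_const _, integral_mul_const]
      simp only [gaussAvg, add_right_comm]
    rw [key]
    simpa using norm_integral_le_of_norm_le_const (μ := centeredGaussian Q)
      (ae_of_all _ fun y => (Real.norm_eq_abs _).trans_le (h.taylor (x + y) v))

/-- Gaussian smoothing to second order. -/
lemma abs_gaussAvg_sub_sub_le (h : HasTaylor K₂ K₃ f f₁ f₂) {Q : Matrix (Fin d) (Fin d) ℝ}
    (hQ : Q.PosSemidef) (x : Fin d → ℝ) :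
    |gaussAvg Q f x - f x - ∑ i, ∑ j, f₂ i j x * Q i j| ≤
      K₃ * ∫ y, ‖y‖ ^ 3 ∂centeredGaussian Q := by
  obtain ⟨B, hB⟩ := h.bdd
  have hi := integrable_comp_add_centeredGaussian Q h.cont hB x
  have hs₁ : Integrable (fun y => ∑ i, f₁ i x * y i) (centeredGaussian Q) :=
    integrable_finsetSum _ fun i _ => (integrable_eval_centeredGaussian Q i).const_mul _
  have hs₂' : ∀ i, Integrable (fun y : Fin d → ℝ => ∑ j, f₂ i j x * (y i * y j))
      (centeredGaussian Q) := fun i => integrable_finsetSum _ fun j _ =>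
    (integrable_eval_mul_eval_centeredGaussian Q i j).const_mul _
  have hs₂ : Integrable (fun y : Fin d → ℝ => ∑ i, ∑ j, f₂ i j x * (y i * y j))
      (centeredGaussian Q) := integrable_finsetSum _ fun i _ => hs₂' i
  have key : gaussAvg Q f x - f x - ∑ i, ∑ j, f₂ i j x * Q i j =
      ∫ y, (f (x + y) - f x - ∑ i, f₁ i x * y i - ∑ i, ∑ j, f₂ i j x * (y i * y j))
        ∂centeredGaussian Q := by
    have hc : Integrable (fun _ : Fin d → ℝ => f x) (centeredGaussian Q) := integrable_const _
    rw [integral_sub_sub_sub hi hc hs₁ hs₂, integral_finsetSum _ fun i _ =>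
        (integrable_eval_centeredGaussian Q i).const_mul _,
      integral_finsetSum _ fun i _ => hs₂' i]
    simp_rw [integral_finsetSum _ fun j _ =>
      (integrable_eval_mul_eval_centeredGaussian Q _ j).const_mul _, integral_const_mul,
      integral_eval_centeredGaussian, integral_eval_mul_eval_centeredGaussian hQ]
    simp [gaussAvg]
  rw [key, ← integral_const_mul]
  exact norm_integral_le_of_norm_le ((integrable_norm_pow_three_centeredGaussian Q).const_mul _)
    (ae_of_all _ fun y => (Real.norm_eq_abs _).trans_le (h.taylor x y))

/-- A crude comparison whose cubic error does not vanish as `Q` approaches `R`. It is useful only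
for small covariances, to which the next two lemmas reduce. -/
lemma abs_gaussAvg_sub_gaussAvg_le_add (h : HasTaylor K₂ K₃ f f₁ f₂)
    {Q R : Matrix (Fin d) (Fin d) ℝ} (hQ : Q.PosSemidef) (hR : R.PosSemidef) (x : Fin d → ℝ) :
    |gaussAvg Q f x - gaussAvg R f x| ≤ K₂ * entryNorm (Q - R) +
      K₃ * (∫ y, ‖y‖ ^ 3 ∂centeredGaussian Q + ∫ y, ‖y‖ ^ 3 ∂centeredGaussian R) := by
  have h₁ := abs_le.1 (h.abs_gaussAvg_sub_sub_le hQ x)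
  have h₂ := abs_le.1 (h.abs_gaussAvg_sub_sub_le hR x)
  have h₃ := abs_le.1 ((abs_sum_mul_le_entryNorm (fun i j => f₂ i j x) (Q - R)).trans
    (mul_le_mul_of_nonneg_right (h.bdd₂ x) (entryNorm_nonneg _)))
  simp only [Matrix.sub_apply, mul_sub, Finset.sum_sub_distrib] at h₃
  rw [abs_le]
  constructor <;> linarith [h₁.1, h₁.2, h₂.1, h₂.2, h₃.1, h₃.2]

end HasTaylor

/-- With `G_Q` for the averaging operator, commutativity gives `G_Q² - G_R² = G_Q (G_Q - G_R) + G_R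
(G_Q - G_R)`, and averaging does not increase the sup norm. -/
lemma abs_gaussAvg_sub_gaussAvg_le_of_half {f : (Fin d → ℝ) → ℝ} (hf : Continuous f) {B : ℝ}
    (hB : ∀ x, |f x| ≤ B) {Q R : Matrix (Fin d) (Fin d) ℝ} (hQ : Q.PosSemidef)
    (hR : R.PosSemidef) {b : ℝ}
    (hb : ∀ x, |gaussAvg Q f x - gaussAvg R f x| ≤ b) (x : Fin d → ℝ) :
    |gaussAvg (Q + Q) f x - gaussAvg (R + R) f x| ≤ 2 * b := by
  have cQ := continuous_gaussAvg Q hf hB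
  have cR := continuous_gaussAvg R hf hB
  have bQ := abs_gaussAvg_le Q hB
  have bR := abs_gaussAvg_le R hB
  have e : gaussAvg (Q + Q) f x - gaussAvg (R + R) f x =
      gaussAvg Q (fun y => gaussAvg Q f y - gaussAvg R f y) x +
      gaussAvg R (fun y => gaussAvg Q f y - gaussAvg R f y) x := by
    rw [gaussAvg_sub Q cQ bQ cR bR, gaussAvg_sub R cQ bQ cR bR, ← gaussAvg_add hQ hQ hf hB,
      ← gaussAvg_add hQ hR hf hB, ← gaussAvg_add hR hQ hf hB, ← gaussAvg_add hR hR hf hB,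
      add_comm R Q]
    ring
  rw [e, two_mul]
  exact (abs_add_le _ _).trans (add_le_add (abs_gaussAvg_le Q hb x) (abs_gaussAvg_le R hb x))

lemma abs_gaussAvg_sub_gaussAvg_le_of_div {f : (Fin d → ℝ) → ℝ} (hf : Continuous f) {B : ℝ}
    (hB : ∀ x, |f x| ≤ B) (k : ℕ) {Q R : Matrix (Fin d) (Fin d) ℝ} (hQ : Q.PosSemidef)
    (hR : R.PosSemidef) {b : ℝ}
    (hb : ∀ x, |gaussAvg ((1 / 2 : ℝ) ^ k • Q) f x - gaussAvg ((1 / 2 : ℝ) ^ k • R) f x| ≤ b)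
    (x : Fin d → ℝ) :
    |gaussAvg Q f x - gaussAvg R f x| ≤ 2 ^ k * b := by
  induction k generalizing b with
  | zero => simpa using hb x
  | succ k ih =>
    have hd : ∀ Q : Matrix (Fin d) (Fin d) ℝ, (1 / 2 : ℝ) ^ k • Q =
        (1 / 2 : ℝ) ^ (k + 1) • Q + (1 / 2 : ℝ) ^ (k + 1) • Q := fun Q => by
      rw [← add_smul]
      congr 1
      ring
    have := ih (b := 2 * b) fun x => by
      rw [hd Q, hd R]
      exact abs_gaussAvg_sub_gaussAvg_le_of_half hf hB (hQ.smul (by positivity))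
        (hR.smul (by positivity)) hb x
    rw [pow_succ, mul_assoc]
    exact this

/-- Gaussian comparison. -/
lemma HasTaylor.abs_gaussAvg_sub_gaussAvg_le {K₂ K₃ : ℝ} {f : (Fin d → ℝ) → ℝ}
    {f₁ : Fin d → (Fin d → ℝ) → ℝ} {f₂ : Fin d → Fin d → (Fin d → ℝ) → ℝ}
    (h : HasTaylor K₂ K₃ f f₁ f₂) {Q R : Matrix (Fin d) (Fin d) ℝ} (hQ : Q.PosSemidef)
    (hR : R.PosSemidef) (x : Fin d → ℝ) :
    |gaussAvg Q f x - gaussAvg R f x| ≤ K₂ * entryNorm (Q - R) := by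
  obtain ⟨B, hB⟩ := h.bdd
  set c := ∫ y, ‖y‖ ^ 3 ∂centeredGaussian Q + ∫ y, ‖y‖ ^ 3 ∂centeredGaussian R with hc
  have key : ∀ m : ℕ, |gaussAvg Q f x - gaussAvg R f x| ≤
      K₂ * entryNorm (Q - R) + K₃ * c * (1 / 2) ^ m := fun m => by
    -- Both Gaussians are cut into `4 ^ m` pieces. The exponent `m * 2` makes the scaling a square,
    -- so the pieces are `2 ^ (-m)` times the original vector. Their third moments shrink by `8 ^
    -- (-m)`, and after summation the cubic error is of order `2 ^ (-m)`, while the covariance term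
    -- does not change.
    have := abs_gaussAvg_sub_gaussAvg_le_of_div h.cont hB (m * 2) hQ hR
      (b := K₂ * ((1 / 2 : ℝ) ^ (m * 2) * entryNorm (Q - R)) +
        K₃ * (((1 / 2 : ℝ) ^ m) ^ 3 * c)) (fun x => by
        refine (h.abs_gaussAvg_sub_gaussAvg_le_add (hQ.smul (by positivity))
          (hR.smul (by positivity)) x).trans_eq ?_
        rw [← smul_sub, entryNorm_smul, abs_of_nonneg (by positivity), pow_mul,
          integral_norm_pow_three_sq_smul _ hQ, integral_norm_pow_three_sq_smul _ hR,
          abs_of_nonneg (by positivity)]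
        ring) x
    refine this.trans_eq ?_
    have e : (2 : ℝ) ^ m * (1 / 2) ^ m = 1 := by
      rw [← mul_pow]; norm_num
    calc _ = ((2 : ℝ) ^ m * (1 / 2) ^ m) ^ 2 * (K₂ * entryNorm (Q - R) + K₃ * c * (1 / 2) ^ m) := by ring
      _ = _ := by rw [e]; ring
  have ht : Tendsto (fun m : ℕ => K₂ * entryNorm (Q - R) + K₃ * c * (1 / 2 : ℝ) ^ m) atTop
      (𝓝 (K₂ * entryNorm (Q - R) + K₃ * c * 0)) :=
    tendsto_const_nhds.add (tendsto_const_nhds.mul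
      (tendsto_pow_atTop_nhds_zero_of_lt_one (by norm_num) (by norm_num)))
  simpa using ge_of_tendsto' ht key

end

/-! ### Smooth cutoff functions on the line. -/

section

lemma abs_le_on_unitInterval_of_hasDerivAt {ψ ψ' : ℝ → ℝ} {K : ℝ} (h0 : ψ 0 = 0)
    (hd : ∀ t, HasDerivAt ψ (ψ' t) t) (hK : ∀ t ∈ Set.Icc (0 : ℝ) 1, |ψ' t| ≤ K) :
    ∀ t ∈ Set.Icc (0 : ℝ) 1, |ψ t| ≤ K := by
  intro t ht
  have hK0 : 0 ≤ K := (abs_nonneg _).trans (hK t ht)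
  have h := (convex_Icc (0 : ℝ) 1).norm_image_sub_le_of_norm_hasDerivWithin_le
    (fun s _ => (hd s).hasDerivWithinAt) (fun s hs => hK s hs)
    (Set.left_mem_Icc.2 zero_le_one) ht
  rw [h0, sub_zero, sub_zero, Real.norm_eq_abs, Real.norm_eq_abs, abs_of_nonneg ht.1] at h
  exact h.trans (mul_le_of_le_one_right hK0 ht.2)

/-- The mean value inequality on `[0, 1]`, applied three times to the successive remainders. The
factor `1 / 6` is given up. -/
lemma abs_taylor_two_le {φ φ₁ φ₂ φ₃ : ℝ → ℝ} {K : ℝ} (h₀ : ∀ t, HasDerivAt φ (φ₁ t) t)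
    (h₁ : ∀ t, HasDerivAt φ₁ (φ₂ t) t) (h₂ : ∀ t, HasDerivAt φ₂ (φ₃ t) t)
    (hK : ∀ t, |φ₃ t| ≤ K) : |φ 1 - φ 0 - φ₁ 0 - φ₂ 0 / 2| ≤ K := by
  have a₂ := abs_le_on_unitInterval_of_hasDerivAt (ψ := fun t => φ₂ t - φ₂ 0) (sub_self _)
    (fun t => (h₂ t).sub_const _) (fun t _ => hK t)
  have a₁ := abs_le_on_unitInterval_of_hasDerivAt (ψ := fun t => φ₁ t - φ₁ 0 - φ₂ 0 * t)
    (ψ' := fun t => φ₂ t - φ₂ 0) (by simp)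
    (fun t => by
      have := ((h₁ t).sub_const (φ₁ 0)).sub ((hasDerivAt_id t).const_mul (φ₂ 0))
      rw [mul_one] at this
      exact this) a₂
  have a₀ := abs_le_on_unitInterval_of_hasDerivAt
    (ψ := fun t => φ t - φ 0 - φ₁ 0 * t - φ₂ 0 / 2 * t ^ 2)
    (ψ' := fun t => φ₁ t - φ₁ 0 - φ₂ 0 * t) (by simp)
    (fun t => by
      have := (((h₀ t).sub_const (φ 0)).sub ((hasDerivAt_id t).const_mul (φ₁ 0))).sub
        ((hasDerivAt_pow 2 t).const_mul (φ₂ 0 / 2))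
      exact this.congr_deriv (by norm_num; ring)) a₁
  simpa using a₀ 1 (Set.right_mem_Icc.2 zero_le_one)

/-- `δ⁻¹ ∫_s^{s+δ} h`. -/
def movingAvg (δ : ℝ) (h : ℝ → ℝ) (s : ℝ) : ℝ := δ⁻¹ * ∫ u in s..(s + δ), h u

lemma hasDerivAt_movingAvg (δ : ℝ) {h : ℝ → ℝ} (hh : Continuous h) (s : ℝ) :
    HasDerivAt (movingAvg δ h) (δ⁻¹ * (h (s + δ) - h s)) s := by
  have e : movingAvg δ h =
      fun s => δ⁻¹ * ((∫ u in (0 : ℝ)..(s + δ), h u) - ∫ u in (0 : ℝ)..s, h u) := by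
    ext s
    rw [movingAvg, intervalIntegral.integral_interval_sub_left (hh.intervalIntegrable _ _)
      (hh.intervalIntegrable _ _)]
  have h₁ : ∀ s, HasDerivAt (fun s => ∫ u in (0 : ℝ)..s, h u) (h s) s := fun s =>
    intervalIntegral.integral_hasDerivAt_right (hh.intervalIntegrable _ _)
      (hh.stronglyMeasurableAtFilter _ _) hh.continuousAt
  rw [e]
  exact (((h₁ (s + δ)).comp_add_const s δ).sub (h₁ s)).const_mul _

/-- `h` is a continuous function with values in `[0, 1]` that is `1` within distance `a` of `A`
and `0` beyond distance `b`. -/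
structure IsCutoff (A : Set ℝ) (a b : ℝ) (h : ℝ → ℝ) : Prop where
  cont : Continuous h
  nonneg : ∀ s, 0 ≤ h s
  le_one : ∀ s, h s ≤ 1
  eq_one : ∀ s, Metric.infDist s A ≤ a → h s = 1
  eq_zero : ∀ s, b ≤ Metric.infDist s A → h s = 0

/-- The average looks only at points within `δ`, and `infDist` is 1-Lipschitz, so each transition
radius moves by at most `δ`. Every averaging gains one derivative. -/
lemma IsCutoff.movingAvg {A : Set ℝ} {a b δ : ℝ} {h : ℝ → ℝ} (H : IsCutoff A a b h)
    (hδ : 0 < δ) : IsCutoff A (a - δ) (b + δ) (movingAvg δ h) := by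
  have hd : ∀ s, ∀ u ∈ Set.uIcc s (s + δ), dist s u ≤ δ := fun s u hu => by
    rw [Set.uIcc_of_le (by linarith)] at hu
    rw [Real.dist_eq, abs_le]
    constructor <;> linarith [hu.1, hu.2]
  refine ⟨continuous_iff_continuousAt.2 fun s => (hasDerivAt_movingAvg δ H.cont s).continuousAt,
    fun s => ?_, fun s => ?_, fun s hs => ?_, fun s hs => ?_⟩
  · exact mul_nonneg (inv_nonneg.2 hδ.le) (intervalIntegral.integral_nonneg (by linarith)
      fun u _ => H.nonneg u)
  · rw [MaxCLT.movingAvg, inv_mul_le_iff₀ hδ, mul_one]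
    have := intervalIntegral.integral_mono_on (μ := volume) (by linarith : s ≤ s + δ)
      (H.cont.intervalIntegrable _ _) (continuous_const.intervalIntegrable _ _)
      (fun u _ => H.le_one u)
    simpa using this
  · have : ∫ u in s..(s + δ), h u = ∫ u in s..(s + δ), (1 : ℝ) :=
      intervalIntegral.integral_congr fun u hu => H.eq_one u (by
        have := Metric.infDist_le_infDist_add_dist (s := A) (x := u) (y := s)
        rw [dist_comm] at this
        linarith [hd s u hu])
    rw [MaxCLT.movingAvg, this]
    simp [hδ.ne']
  · have : ∫ u in s..(s + δ), h u = ∫ u in s..(s + δ), (0 : ℝ) :=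
      intervalIntegral.integral_congr fun u hu => H.eq_zero u (by
        have := Metric.infDist_le_infDist_add_dist (s := A) (x := s) (y := u)
        linarith [hd s u hu])
    rw [MaxCLT.movingAvg, this]
    simp

/-- A thrice differentiable cutoff function with scale invariant bounds. -/
lemma exists_smooth_cutoff (A : Set ℝ) {δ : ℝ} (hδ : 0 < δ) :
    ∃ g g₁ g₂ g₃ : ℝ → ℝ, IsCutoff A δ (8 * δ) g ∧ (∀ s, HasDerivAt g (g₁ s) s) ∧
      (∀ s, HasDerivAt g₁ (g₂ s) s) ∧ (∀ s, HasDerivAt g₂ (g₃ s) s) ∧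
      (∀ s, |g₁ s| ≤ 1 / δ) ∧ (∀ s, |g₂ s| ≤ 2 / δ ^ 2) ∧ ∀ s, |g₃ s| ≤ 4 / δ ^ 3 := by
  -- A piecewise linear profile between radii `4 δ` and `5 δ`: three averagings turn these into `δ`
  -- and `8 δ`. The inner margin `δ` will absorb the error of the smooth maximum.
  let h : ℝ → ℝ := fun s => max 0 (min 1 (5 - Metric.infDist s A / δ))
  have hc : IsCutoff A (4 * δ) (5 * δ) h := by
    refine ⟨?_, fun s => le_max_left _ _, fun s => max_le zero_le_one (min_le_left _ _),
      fun s hs => ?_, fun s hs => ?_⟩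
    · have := Metric.continuous_infDist_pt A
      fun_prop
    · have : Metric.infDist s A / δ ≤ 4 := by rwa [div_le_iff₀ hδ]
      simp only [h]
      rw [min_eq_left (by linarith), max_eq_right zero_le_one]
    · have : 5 ≤ Metric.infDist s A / δ := by rwa [le_div_iff₀ hδ]
      simp only [h]
      rw [max_eq_left ((min_le_right _ _).trans (by linarith))]
  have hc₁ := hc.movingAvg hδ
  have hc₂ := hc₁.movingAvg hδ
  have hc₃ := hc₂.movingAvg hδ
  rw [show 4 * δ - δ - δ - δ = δ by ring, show 5 * δ + δ + δ + δ = 8 * δ by ring] at hc₃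
  set m₁ := movingAvg δ h
  set m₂ := movingAvg δ m₁
  have d₁ := hasDerivAt_movingAvg δ hc.cont
  have d₂ := hasDerivAt_movingAvg δ hc₁.cont
  have d₃ := hasDerivAt_movingAvg δ hc₂.cont
  -- The `k`-th derivative is a `k`-th difference, divided by `δ ^ k`, of a function with values in
  -- `[0, 1]`; the differences are at most `1`, `2` and `4` in absolute value.
  refine ⟨_, _, fun s => δ⁻¹ * (δ⁻¹ * (m₁ (s + δ + δ) - m₁ (s + δ)) - δ⁻¹ * (m₁ (s + δ) - m₁ s)),
    fun s => δ⁻¹ * (δ⁻¹ * (δ⁻¹ * (h (s + δ + δ + δ) - h (s + δ + δ)) -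
      δ⁻¹ * (h (s + δ + δ) - h (s + δ))) - δ⁻¹ * (δ⁻¹ * (h (s + δ + δ) - h (s + δ)) -
      δ⁻¹ * (h (s + δ) - h s))), hc₃, d₃, fun s => ?_, fun s => ?_, fun s => ?_, fun s => ?_,
    fun s => ?_⟩
  · exact (((d₂ (s + δ)).comp_add_const s δ).sub (d₂ s)).const_mul _
  · have e₁ := (d₁ (s + δ)).comp_add_const s δ
    have e₂ : HasDerivAt (fun s => m₁ (s + δ + δ)) (δ⁻¹ * (h (s + δ + δ + δ) - h (s + δ + δ))) s :=
      HasDerivAt.comp_add_const (f := fun s => m₁ (s + δ)) s δ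
        ((d₁ (s + δ + δ)).comp_add_const (s + δ) δ)
    exact (((e₂.sub e₁).const_mul _).sub ((e₁.sub (d₁ s)).const_mul _)).const_mul _
  · rw [abs_mul, abs_of_pos (inv_pos.2 hδ), ← one_div]
    refine mul_le_of_le_one_right (by positivity) (abs_le.2 ?_)
    constructor <;> linarith [hc₂.nonneg s, hc₂.nonneg (s + δ), hc₂.le_one s, hc₂.le_one (s + δ)]
  · beta_reduce
    rw [show ∀ a b c : ℝ, δ⁻¹ * (δ⁻¹ * (a - b) - δ⁻¹ * (b - c)) = (a - 2 * b + c) / δ ^ 2 from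
      fun a b c => by field_simp; ring, abs_div, abs_of_pos (by positivity : 0 < δ ^ 2)]
    refine div_le_div_of_nonneg_right (abs_le.2 ?_) (by positivity)
    constructor <;> linarith [hc₁.nonneg s, hc₁.nonneg (s + δ), hc₁.le_one s, hc₁.le_one (s + δ),
      hc₁.nonneg (s + δ + δ), hc₁.le_one (s + δ + δ)]
  · beta_reduce
    rw [show ∀ a b c e : ℝ, δ⁻¹ * (δ⁻¹ * (δ⁻¹ * (e - a) - δ⁻¹ * (a - b)) -
      δ⁻¹ * (δ⁻¹ * (a - b) - δ⁻¹ * (b - c))) = (e - 3 * a + 3 * b - c) / δ ^ 3 from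
      fun a b c e => by field_simp; ring, abs_div, abs_of_pos (by positivity : 0 < δ ^ 3)]
    refine div_le_div_of_nonneg_right (abs_le.2 ?_) (by positivity)
    constructor <;> linarith [hc.nonneg s, hc.nonneg (s + δ), hc.le_one s, hc.le_one (s + δ),
      hc.nonneg (s + δ + δ), hc.le_one (s + δ + δ), hc.nonneg (s + δ + δ + δ),
      hc.le_one (s + δ + δ + δ)]

end

/-! ### The smooth maximum and its derivatives along lines. -/

section

variable {d : ℕ}

lemma le_maxCoord (x : Fin d → ℝ) (i : Fin d) : x i ≤ maxCoord x :=
  le_ciSup (Set.finite_range x).bddAbove i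

def expSum (β : ℝ) (x : Fin d → ℝ) : ℝ := ∑ i, Real.exp (β * x i)

/-- The smooth maximum `β⁻¹ log ∑ exp (β x_i)`. -/
def softMax (β : ℝ) (x : Fin d → ℝ) : ℝ := β⁻¹ * Real.log (expSum β x)

/-- The gradient of `softMax`. -/
def softWeight (β : ℝ) (i : Fin d) (x : Fin d → ℝ) : ℝ := Real.exp (β * x i) / expSum β x

/-- The moments of the coordinates of `h` under the weights at `x`. -/
def softMoment (β : ℝ) (h : Fin d → ℝ) (k : ℕ) (x : Fin d → ℝ) : ℝ :=
  ∑ i, softWeight β i x * h i ^ k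

lemma continuous_expSum (β : ℝ) : Continuous (expSum β : (Fin d → ℝ) → ℝ) := by
  unfold expSum; fun_prop

lemma hasDerivAt_exp_line (β : ℝ) (x h : Fin d → ℝ) (t : ℝ) (i : Fin d) :
    HasDerivAt (fun t => Real.exp (β * (x + t • h) i))
      (Real.exp (β * (x + t • h) i) * (β * h i)) t := by
  have : HasDerivAt (fun t : ℝ => β * (x + t • h) i) (β * h i) t := by
    simpa using (((hasDerivAt_id t).mul_const (h i)).const_add (x i)).const_mul β
  exact this.exp

section

variable [NeZero d] (β : ℝ)

lemma expSum_pos (x : Fin d → ℝ) : 0 < expSum β x :=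
  Finset.sum_pos (fun _ _ => Real.exp_pos _) Finset.univ_nonempty

lemma softWeight_nonneg (i : Fin d) (x : Fin d → ℝ) : 0 ≤ softWeight β i x :=
  div_nonneg (Real.exp_pos _).le (expSum_pos β x).le

lemma sum_softWeight (x : Fin d → ℝ) : ∑ i, softWeight β i x = 1 := by
  simp only [softWeight, ← Finset.sum_div]
  exact div_self (expSum_pos β x).ne'

lemma continuous_softMax : Continuous (softMax β : (Fin d → ℝ) → ℝ) :=
  continuous_const.mul ((continuous_expSum β).log fun x => (expSum_pos β x).ne')

lemma continuous_softWeight (i : Fin d) : Continuous (softWeight β i) :=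
  Continuous.div (by fun_prop) (continuous_expSum β) fun x => (expSum_pos β x).ne'

/-- The weights form a probability vector, so the bound is free of the dimension. -/
lemma abs_softMoment_le (h : Fin d → ℝ) (k : ℕ) (x : Fin d → ℝ) :
    |softMoment β h k x| ≤ ‖h‖ ^ k := by
  calc |softMoment β h k x| ≤ ∑ i, softWeight β i x * ‖h‖ ^ k := by
        refine (Finset.abs_sum_le_sum_abs _ _).trans (Finset.sum_le_sum fun i _ => ?_)
        rw [abs_mul, abs_of_nonneg (softWeight_nonneg β i x), abs_pow]
        exact mul_le_mul_of_nonneg_left (pow_le_pow_left₀ (abs_nonneg _) (norm_le_pi_norm h i) k)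
          (softWeight_nonneg β i x)
    _ = ‖h‖ ^ k := by rw [← Finset.sum_mul, sum_softWeight, one_mul]

variable (x h : Fin d → ℝ) (t : ℝ)

lemma hasDerivAt_expSum_line :
    HasDerivAt (fun t => expSum β (x + t • h))
      (expSum β (x + t • h) * (β * softMoment β h 1 (x + t • h))) t := by
  have := HasDerivAt.fun_sum (u := Finset.univ) fun i _ => hasDerivAt_exp_line β x h t i
  refine this.congr_deriv ?_
  have hp := (expSum_pos β (x + t • h)).ne'
  simp only [softMoment, softWeight, Finset.mul_sum]
  refine Finset.sum_congr rfl fun i _ => ?_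
  field_simp

lemma hasDerivAt_softMax_line (hβ : β ≠ 0) :
    HasDerivAt (fun t => softMax β (x + t • h)) (softMoment β h 1 (x + t • h)) t := by
  have hp := (expSum_pos β (x + t • h)).ne'
  refine (((hasDerivAt_expSum_line β x h t).log hp).const_mul β⁻¹).congr_deriv ?_
  field_simp

lemma hasDerivAt_softWeight_line (i : Fin d) :
    HasDerivAt (fun t => softWeight β i (x + t • h))
      (β * (softWeight β i (x + t • h) * h i -
        softWeight β i (x + t • h) * softMoment β h 1 (x + t • h))) t := by
  have hp := (expSum_pos β (x + t • h)).ne'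
  refine ((hasDerivAt_exp_line β x h t i).div (hasDerivAt_expSum_line β x h t) hp).congr_deriv ?_
  simp only [softWeight]
  field_simp

/-- The weights are an exponential family: differentiating a mean along `h` gives `β` times its
covariance with `h`. The moments thus form a closed system, from which all derivatives of the smooth
maximum are computed. -/
lemma hasDerivAt_softMoment_line (k : ℕ) :
    HasDerivAt (fun t => softMoment β h k (x + t • h))
      (β * (softMoment β h (k + 1) (x + t • h) -
        softMoment β h k (x + t • h) * softMoment β h 1 (x + t • h))) t := by
  have := HasDerivAt.fun_sum (u := Finset.univ) fun i _ =>
    (hasDerivAt_softWeight_line β x h t i).mul_const (h i ^ k)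
  refine this.congr_deriv ?_
  rw [softMoment.eq_1 β h (k + 1), softMoment.eq_1 β h k, Finset.sum_mul, ← Finset.sum_sub_distrib, Finset.mul_sum]
  refine Finset.sum_congr rfl fun i _ => ?_
  ring

lemma maxCoord_le_softMax (hβ : 0 < β) : maxCoord x ≤ softMax β x := by
  refine ciSup_le fun i => ?_
  rw [softMax, le_inv_mul_iff₀ hβ, Real.le_log_iff_exp_le (expSum_pos β x)]
  exact Finset.single_le_sum (f := fun i => Real.exp (β * x i)) (fun i _ => (Real.exp_pos _).le)
    (Finset.mem_univ i)

lemma softMax_le_maxCoord_add (hβ : 0 < β) : softMax β x ≤ maxCoord x + Real.log d / β := by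
  have hd : (0 : ℝ) < d := by exact_mod_cast Nat.pos_of_ne_zero (NeZero.ne d)
  rw [softMax, inv_mul_le_iff₀ hβ, Real.log_le_iff_le_exp (expSum_pos β x), mul_add,
    mul_div_cancel₀ _ hβ.ne', Real.exp_add, Real.exp_log hd, mul_comm]
  calc expSum β x ≤ ∑ _i : Fin d, Real.exp (β * maxCoord x) := by
        refine Finset.sum_le_sum fun i _ => Real.exp_le_exp.2 ?_
        exact mul_le_mul_of_nonneg_left (le_maxCoord x i) hβ.le
    _ = _ := by simp

end

section

variable [NeZero d]

/-- The composition of a smooth function with the smooth maximum. -/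
lemma hasTaylor_comp_softMax {β : ℝ} (hβ : 0 < β) {g g₁ g₂ g₃ : ℝ → ℝ} {B b₁ b₂ b₃ : ℝ}
    (hB : ∀ s, |g s| ≤ B)
    (h₁ : ∀ s, HasDerivAt g (g₁ s) s) (h₂ : ∀ s, HasDerivAt g₁ (g₂ s) s)
    (h₃ : ∀ s, HasDerivAt g₂ (g₃ s) s) (hb₁ : ∀ s, |g₁ s| ≤ b₁) (hb₂ : ∀ s, |g₂ s| ≤ b₂)
    (hb₃ : ∀ s, |g₃ s| ≤ b₃) :
    HasTaylor (d := d) (b₂ / 2 + β * b₁) (b₃ + 6 * β * b₂ + 6 * β ^ 2 * b₁)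
      (fun x => g (softMax β x)) (fun i x => g₁ (softMax β x) * softWeight β i x)
      (fun i j x => (g₂ (softMax β x) * (softWeight β i x * softWeight β j x) +
        g₁ (softMax β x) * β * ((if i = j then softWeight β i x else 0) -
          softWeight β i x * softWeight β j x)) / 2) := by
  have c : Continuous g := continuous_iff_continuousAt.2 fun s => (h₁ s).continuousAt
  have c₁ : Continuous g₁ := continuous_iff_continuousAt.2 fun s => (h₂ s).continuousAt
  have c₂ : Continuous g₂ := continuous_iff_continuousAt.2 fun s => (h₃ s).continuousAt
  have cM := continuous_softMax (d := d) β
  have cW := continuous_softWeight (d := d) β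
  have hb₁0 : 0 ≤ b₁ := (abs_nonneg _).trans (hb₁ 0)
  have hb₂0 : 0 ≤ b₂ := (abs_nonneg _).trans (hb₂ 0)
  have hb₃0 : 0 ≤ b₃ := (abs_nonneg _).trans (hb₃ 0)
  have w0 := softWeight_nonneg (d := d) β
  have w1 := sum_softWeight (d := d) β
  refine ⟨c.comp cM, fun i => (c₁.comp cM).mul (cW i), fun i j => ?_, ⟨B, fun x => hB _⟩,
    ⟨b₁, fun i x => ?_⟩, fun x => ?_, fun x h => ?_⟩
  · have e₁ := c₁.comp cM
    have e₂ := c₂.comp cM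
    simp only [Function.comp_def] at e₁ e₂
    have := cW i
    have := cW j
    split_ifs <;> fun_prop
  · rw [abs_mul, abs_of_nonneg (w0 i x)]
    have hw : softWeight β i x ≤ 1 := by
      rw [← w1 x]
      exact Finset.single_le_sum (fun j _ => w0 j x) (Finset.mem_univ i)
    exact (mul_le_of_le_one_right (abs_nonneg _) hw).trans (hb₁ _)
  · calc _ ≤ ∑ i, ∑ j, (b₂ * (softWeight β i x * softWeight β j x) + b₁ * β *
          ((if i = j then softWeight β i x else 0) + softWeight β i x * softWeight β j x)) / 2 := by
          refine Finset.sum_le_sum fun i _ => Finset.sum_le_sum fun j _ => ?_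
          have hi := w0 i x
          have hij := mul_nonneg (w0 i x) (w0 j x)
          have hite : 0 ≤ if i = j then softWeight β i x else 0 := by split_ifs <;> simp [hi]
          rw [abs_div, abs_two]
          refine div_le_div_of_nonneg_right ((abs_add_le _ _).trans (add_le_add ?_ ?_)) zero_le_two
          · rw [abs_mul, abs_of_nonneg hij]
            exact mul_le_mul_of_nonneg_right (hb₂ _) hij
          · rw [abs_mul, abs_mul, abs_of_pos hβ]
            refine mul_le_mul (mul_le_mul_of_nonneg_right (hb₁ _) hβ.le) ?_ (abs_nonneg _)
              (by positivity)
            refine (abs_sub _ _).trans_eq ?_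
            rw [abs_of_nonneg hij, abs_of_nonneg hite]
      _ = b₂ / 2 + β * b₁ := by
          simp only [← Finset.sum_div, Finset.sum_add_distrib, ← Finset.mul_sum, Finset.sum_ite_eq,
            Finset.mem_univ, if_true, w1, mul_one]
          ring
  · have dM := fun t => hasDerivAt_softMax_line β x h t hβ.ne'
    have da := fun k t => hasDerivAt_softMoment_line β x h t k
    have a₁ := fun y => abs_softMoment_le β h 1 y
    have a₂ := fun y => abs_softMoment_le β h 2 y
    have a₃ := fun y => abs_softMoment_le β h 3 y
    set m : ℕ → ℝ → ℝ := fun k t => softMoment β h k (x + t • h) with hm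
    set L : ℝ → ℝ := fun t => softMax β (x + t • h) with hL
    -- Here `L' = m 1`, so the second and third derivatives of `L` are `β` times the variance and `β
    -- ^ 2` times the third cumulant of the coordinates of `h` under the weights. These are bounded
    -- by `2 ‖h‖ ^ 2` and `6 ‖h‖ ^ 3`.
    have T := abs_taylor_two_le (φ := fun t => g (L t)) (φ₁ := fun t => g₁ (L t) * m 1 t)
      (φ₂ := fun t => g₂ (L t) * m 1 t ^ 2 + g₁ (L t) * (β * (m 2 t - m 1 t * m 1 t)))
      (φ₃ := fun t => g₃ (L t) * m 1 t ^ 3 + 3 * β * g₂ (L t) * m 1 t * (m 2 t - m 1 t * m 1 t) +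
        β ^ 2 * g₁ (L t) * (m 3 t - m 2 t * m 1 t - 2 * (m 2 t - m 1 t * m 1 t) * m 1 t))
      (K := (b₃ + 6 * β * b₂ + 6 * β ^ 2 * b₁) * ‖h‖ ^ 3)
      (fun t => (h₁ (L t)).comp t (dM t))
      (fun t => (((h₂ (L t)).comp t (dM t)).mul (da 1 t)).congr_deriv (by
        simp only [hm, Function.comp_def, hL]; ring))
      (fun t => ((((h₃ (L t)).comp t (dM t)).mul ((da 1 t).pow 2)).add
        (((h₂ (L t)).comp t (dM t)).mul (((da 2 t).sub ((da 1 t).mul (da 1 t))).const_mul β))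
        ).congr_deriv (by
          simp only [hm, Function.comp_def, hL, Pi.pow_apply, Pi.sub_apply, Pi.mul_apply]; ring))
      (fun t => by
        have B₁ : |m 1 t| ≤ ‖h‖ := by simpa using a₁ (x + t • h)
        have B₂ : |m 2 t| ≤ ‖h‖ ^ 2 := a₂ (x + t • h)
        have B₃ : |m 3 t| ≤ ‖h‖ ^ 3 := a₃ (x + t • h)
        have N := norm_nonneg h
        have B₁₁ : |m 1 t * m 1 t| ≤ ‖h‖ ^ 2 := by
          rw [abs_mul, sq]; exact mul_le_mul B₁ B₁ (abs_nonneg _) N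
        have V : |m 2 t - m 1 t * m 1 t| ≤ 2 * ‖h‖ ^ 2 := by
          refine (abs_sub _ _).trans ?_; linarith
        have V₁ : |(m 2 t - m 1 t * m 1 t) * m 1 t| ≤ 2 * ‖h‖ ^ 3 := by
          rw [abs_mul]
          calc _ ≤ 2 * ‖h‖ ^ 2 * ‖h‖ := mul_le_mul V B₁ (abs_nonneg _) (by positivity)
            _ = _ := by ring
        have V₂ : |m 2 t * m 1 t| ≤ ‖h‖ ^ 3 := by
          rw [abs_mul]
          calc _ ≤ ‖h‖ ^ 2 * ‖h‖ := mul_le_mul B₂ B₁ (abs_nonneg _) (by positivity)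
            _ = _ := by ring
        have V₃ : |m 3 t - m 2 t * m 1 t - 2 * (m 2 t - m 1 t * m 1 t) * m 1 t| ≤
            6 * ‖h‖ ^ 3 := by
          have := abs_le.1 V₁
          have := abs_le.1 V₂
          have := abs_le.1 B₃
          rw [abs_le]
          constructor <;> linarith
        have W₁ : |g₃ (L t) * m 1 t ^ 3| ≤ b₃ * ‖h‖ ^ 3 := by
          rw [abs_mul, abs_pow]
          exact mul_le_mul (hb₃ _) (pow_le_pow_left₀ (abs_nonneg _) B₁ 3) (by positivity) hb₃0
        have W₂ : |3 * β * g₂ (L t) * m 1 t * (m 2 t - m 1 t * m 1 t)| ≤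
            3 * β * b₂ * (2 * ‖h‖ ^ 3) := by
          rw [mul_assoc, mul_comm (m 1 t), abs_mul, abs_mul (3 * β),
            abs_of_pos (by positivity : 0 < 3 * β)]
          exact mul_le_mul (mul_le_mul_of_nonneg_left (hb₂ _) (by positivity)) V₁ (abs_nonneg _)
            (by positivity)
        have W₃ : |β ^ 2 * g₁ (L t) * (m 3 t - m 2 t * m 1 t -
            2 * (m 2 t - m 1 t * m 1 t) * m 1 t)| ≤ β ^ 2 * b₁ * (6 * ‖h‖ ^ 3) := by
          rw [abs_mul, abs_mul (β ^ 2), abs_of_pos (by positivity : 0 < β ^ 2)]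
          exact mul_le_mul (mul_le_mul_of_nonneg_left (hb₁ _) (by positivity)) V₃ (abs_nonneg _)
            (by positivity)
        refine (abs_add_three _ _ _).trans ?_
        linarith)
    have e : ∑ i, ∑ j, (g₂ (softMax β x) * (softWeight β i x * softWeight β j x) +
        g₁ (softMax β x) * β * ((if i = j then softWeight β i x else 0) -
          softWeight β i x * softWeight β j x)) / 2 * (h i * h j) =
        (g₂ (L 0) * m 1 0 ^ 2 + g₁ (L 0) * (β * (m 2 0 - m 1 0 * m 1 0))) / 2 := by
      have s₁ : ∑ i, ∑ j, softWeight β i x * softWeight β j x * (h i * h j) = m 1 0 * m 1 0 := by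
        simp only [hm, softMoment, Finset.sum_mul_sum, zero_smul, add_zero, pow_one]
        refine Finset.sum_congr rfl fun i _ => Finset.sum_congr rfl fun j _ => by ring
      have s₂ : ∑ i, ∑ j, (if i = j then softWeight β i x else 0) * (h i * h j) = m 2 0 := by
        simp only [hm, softMoment, zero_smul, add_zero, ite_mul, zero_mul, Finset.sum_ite_eq,
          Finset.mem_univ, if_true, sq]
      have hL0 : L 0 = softMax β x := by simp [hL]
      rw [hL0, ← s₂, sq, ← s₁]
      simp only [Finset.mul_sum, ← Finset.sum_sub_distrib, ← Finset.sum_add_distrib,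
        Finset.sum_div]
      refine Finset.sum_congr rfl fun i _ => Finset.sum_congr rfl fun j _ => by ring
    have e₁ : ∑ i, g₁ (softMax β x) * softWeight β i x * h i = g₁ (L 0) * m 1 0 := by
      simp [hL, hm, softMoment, Finset.mul_sum, mul_assoc]
    rw [e, e₁]
    simpa [hL] using T

end

/-- Lets constants and lower powers of `log d` be absorbed into the leading power. -/
lemma log_natCast_ge_half (hd : 2 ≤ d) : 1 / 2 ≤ Real.log d := by
  have h2 : Real.log 2 ≤ Real.log d := Real.log_le_log (by norm_num) (by exact_mod_cast hd)
  linarith [Real.log_two_gt_d9]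

/-- A smooth function between the indicators of `max x ∈ A` and `max x ∈ A^{9δ}`. -/
lemma exists_hasTaylor_cutoff (hd : 2 ≤ d) {δ : ℝ} (hδ : 0 < δ) {A : Set ℝ} (hA : A.Nonempty) :
    ∃ f f₁ f₂, HasTaylor (d := d) (3 * Real.log d / δ ^ 2) (46 * Real.log d ^ 2 / δ ^ 3) f f₁ f₂ ∧
      (∀ x, 0 ≤ f x) ∧ (∀ x, f x ≤ 1) ∧ (∀ x, maxCoord x ∈ A → f x = 1) ∧
      ∀ x, maxCoord x ∉ Metric.cthickening (9 * δ) A → f x = 0 := by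
  have hl := log_natCast_ge_half hd
  have : NeZero d := ⟨by omega⟩
  obtain ⟨g, g₁, g₂, g₃, hg, h₁, h₂, h₃, hb₁, hb₂, hb₃⟩ := exists_smooth_cutoff A hδ
  set l := Real.log d with hldef
  -- With `β = l / δ` the error `log d / β` of the smooth maximum is exactly `δ`.
  have hβ : 0 < l / δ := by positivity
  have H := hasTaylor_comp_softMax (d := d) hβ (B := 1)
    (fun s => abs_le.2 ⟨by linarith [hg.nonneg s], hg.le_one s⟩) h₁ h₂ h₃ hb₁ hb₂ hb₃
  have hdist : ∀ x : Fin d → ℝ, |softMax (l / δ) x - maxCoord x| ≤ δ := fun x => by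
    have u := maxCoord_le_softMax (l / δ) x hβ
    have v := softMax_le_maxCoord_add (l / δ) x hβ
    rw [← hldef, div_div_cancel₀ (by positivity)] at v
    rw [abs_le]
    constructor <;> linarith
  refine ⟨_, _, _, ⟨H.cont, H.cont₁, H.cont₂, H.bdd, H.bdd₁, fun x => (H.bdd₂ x).trans ?_,
    fun x h => (H.taylor x h).trans (mul_le_mul_of_nonneg_right ?_ (by positivity))⟩,
    fun x => hg.nonneg _, fun x => hg.le_one _, fun x hx => hg.eq_one _ ?_,
    fun x hx => hg.eq_zero _ ?_⟩
  · have e : 2 / δ ^ 2 / 2 + l / δ * (1 / δ) = (1 + l) / δ ^ 2 := by field_simp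
    rw [e]
    exact div_le_div_of_nonneg_right (by linarith) (by positivity)
  · have e : 4 / δ ^ 3 + 6 * (l / δ) * (2 / δ ^ 2) + 6 * (l / δ) ^ 2 * (1 / δ) =
      (4 + 12 * l + 6 * l ^ 2) / δ ^ 3 := by field_simp; ring
    rw [e]
    -- Since `1 ≤ 2 * l`, one has `4 ≤ 16 * l ^ 2` and `12 * l ≤ 24 * l ^ 2`, and `16 + 24 + 6 =
    -- 46`.
    exact div_le_div_of_nonneg_right (by nlinarith) (by positivity)
  · refine (Metric.infDist_le_dist_of_mem hx).trans ?_
    rw [Real.dist_eq]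
    exact hdist x
  · by_contra! hlt
    refine hx ?_
    have : Metric.infDist (maxCoord x) A ≤ 9 * δ := by
      have := Metric.infDist_le_infDist_add_dist (s := A) (x := maxCoord x)
        (y := softMax (l / δ) x)
      rw [dist_comm, Real.dist_eq] at this
      linarith [hdist x]
    rw [Metric.mem_cthickening_iff,
      ENNReal.le_ofReal_iff_toReal_le (Metric.infEDist_ne_top hA) (by positivity)]
    exact this

end

/-! ### One step of the replacement argument. -/

section

variable {d : ℕ}

lemma measurable_gaussAvg_comp {Ω : Type*} {m : MeasurableSpace Ω}
    {Q : Ω → Matrix (Fin d) (Fin d) ℝ} {X : Ω → Fin d → ℝ}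
    (hQm : ∀ i j, Measurable fun ω => Q ω i j) (hQ : ∀ ω, (Q ω).PosSemidef) (hX : Measurable X)
    {f : (Fin d → ℝ) → ℝ} (hf : Continuous f) {B : ℝ} (hB : ∀ x, |f x| ≤ B) :
    Measurable fun ω => gaussAvg (Q ω) f (X ω) := by
  have hc := continuousOn_iff_continuous_domRestrict.1 (continuousOn_gaussAvg hf hB)
  have hQ' : Measurable fun ω => ((fun i j => Q ω i j : Fin d → Fin d → ℝ), X ω) :=
    (measurable_pi_iff.2 fun i => measurable_pi_iff.2 fun j => hQm i j).prodMk hX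
  have hs : Measurable fun ω => (⟨((fun i j => Q ω i j : Fin d → Fin d → ℝ), X ω), hQ ω⟩ :
      {p : (Fin d → Fin d → ℝ) × (Fin d → ℝ) | (Matrix.of p.1).PosSemidef}) :=
    hQ'.subtype_mk
  have hcm := hc.measurable
  have := hcm.comp hs
  exact this

lemma isClosed_setOf_posSemidef :
    IsClosed {q : Fin d → Fin d → ℝ | (Matrix.of q).PosSemidef} := by
  have : {q : Fin d → Fin d → ℝ | (Matrix.of q).PosSemidef} =
      {q | ∀ i j, q i j = q j i} ∩ {q | ∀ x : Fin d → ℝ, 0 ≤ x ⬝ᵥ (Matrix.of q *ᵥ x)} := by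
    ext q
    simp only [posSemidef_iff_dotProduct_mulVec, Set.mem_ofPred_eq, Set.mem_inter_iff]
    refine and_congr ?_ (by simp)
    exact ⟨fun h i j => by simpa using h.apply j i, fun h => IsHermitian.ext fun i j => by
      simpa using h j i⟩
  rw [this]
  have hof : Continuous fun q : Fin d → Fin d → ℝ => (Matrix.of q : Matrix (Fin d) (Fin d) ℝ) :=
    continuous_id
  refine IsClosed.inter ?_ ?_
  · simp only [Set.ofPred_forall]
    exact isClosed_iInter fun i => isClosed_iInter fun j =>
      isClosed_eq (by fun_prop) (by fun_prop)
  · simp only [Set.ofPred_forall]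
    exact isClosed_iInter fun x => isClosed_le continuous_const (by fun_prop)

lemma measurableSet_posSemidef {Ω : Type*} {m : MeasurableSpace Ω}
    {Q : Ω → Matrix (Fin d) (Fin d) ℝ} (hQm : ∀ i j, Measurable fun ω => Q ω i j) :
    MeasurableSet {ω | (Q ω).PosSemidef} := by
  have hQ' : Measurable fun ω => (fun i j => Q ω i j : Fin d → Fin d → ℝ) :=
    measurable_pi_iff.2 fun i => measurable_pi_iff.2 fun j => hQm i j
  exact hQ' isClosed_setOf_posSemidef.measurableSet

section

variable {Ω : Type*} {m mΩ : MeasurableSpace Ω} {P : Measure Ω} [IsProbabilityMeasure P]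

omit [IsProbabilityMeasure P] in
lemma integrable_bdd_mul {b Z : Ω → ℝ} (hb : Measurable b) {B : ℝ} (hB : ∀ ω, |b ω| ≤ B)
    (hZ : Integrable Z P) : Integrable (fun ω => b ω * Z ω) P :=
  hZ.bdd_mul hb.aestronglyMeasurable (ae_of_all _ hB)

/-- Pulling out the known factor `b`; the set `G` is known as well, so the integral over it sees
only the conditional expectation. -/
lemma setIntegral_mul_eq_setIntegral_mul_condExp (hm : m ≤ mΩ) {G : Set Ω}
    (hG : MeasurableSet[m] G) {b Z W : Ω → ℝ} (hb : Measurable[m] b) {B : ℝ}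
    (hB : ∀ ω, |b ω| ≤ B) (hZ : Integrable Z P) (hW : P[Z | m] =ᵐ[P] W) :
    ∫ ω in G, b ω * Z ω ∂P = ∫ ω in G, b ω * W ω ∂P := by
  have hbZ : Integrable (b * Z) P := integrable_bdd_mul (hb.mono hm le_rfl) hB hZ
  have h := condExp_mul_of_stronglyMeasurable_left hb.stronglyMeasurable hbZ hZ
  change ∫ ω in G, (b * Z) ω ∂P = _
  rw [← setIntegral_condExp hm hbZ hG]
  refine integral_congr_ae (ae_restrict_of_ae ?_)
  filter_upwards [h, hW] with ω h₁ h₂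
  rw [h₁, Pi.mul_apply, h₂]

/-- One step of Lindeberg's replacement argument: a conditionally centered increment is replaced
by a conditionally Gaussian one with the same conditional covariance `Γ`. -/
lemma HasTaylor.setIntegral_gaussAvg_add_le {K₂ K₃ : ℝ} {f : (Fin d → ℝ) → ℝ}
    {f₁ : Fin d → (Fin d → ℝ) → ℝ} {f₂ : Fin d → Fin d → (Fin d → ℝ) → ℝ}
    (h : HasTaylor K₂ K₃ f f₁ f₂) (hm : m ≤ mΩ) {G : Set Ω} (hG : MeasurableSet[m] G)
    {X ξ : Ω → Fin d → ℝ} {Q Q' Γ : Ω → Matrix (Fin d) (Fin d) ℝ} {c : Ω → ℝ}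
    (hX : Measurable[m] X) (hQm : ∀ i j, Measurable[m] fun ω => Q ω i j)
    (hQ : ∀ ω, (Q ω).PosSemidef) (hQm' : ∀ i j, Measurable[m] fun ω => Q' ω i j)
    (hQ' : ∀ ω, (Q' ω).PosSemidef) (hQQ' : ∀ ω ∈ G, Q' ω = Q ω + Γ ω)
    (hΓ : ∀ᵐ ω ∂P, (Γ ω).PosSemidef)
    (hΓc : ∀ i j, P[fun ω => ξ ω i * ξ ω j | m] =ᵐ[P] fun ω => Γ ω i j)
    (hξm : Measurable ξ) (hξ0 : ∀ i, P[fun ω => ξ ω i | m] =ᵐ[P] 0) (hξ2 : MemLp ξ 2 P)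
    (hξ3 : Integrable (fun ω => ‖ξ ω‖ ^ 3) P) (hc : Integrable c P)
    (hΓ3 : ∀ᵐ ω ∂P, ∫ y, ‖y‖ ^ 3 ∂centeredGaussian (Γ ω) ≤ c ω) (hK₃ : 0 ≤ K₃) :
    ∫ ω in G, gaussAvg (Q ω) f (X ω + ξ ω) ∂P ≤ ∫ ω in G, gaussAvg (Q' ω) f (X ω) ∂P +
      K₃ * (∫ ω, ‖ξ ω‖ ^ 3 ∂P + ∫ ω, c ω ∂P) := by
  obtain ⟨B, hB⟩ := h.bdd
  obtain ⟨B₁, hB₁⟩ := h.bdd₁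
  have hQmΩ : ∀ i j, Measurable fun ω => Q ω i j := fun i j => (hQm i j).mono hm le_rfl
  have hξi : ∀ i, MemLp (fun ω => ξ ω i) 2 P := fun i => (memLp_pi_iff.1 hξ2) i
  have hi₁ : ∀ i, Integrable (fun ω => ξ ω i) P := fun i => (hξi i).integrable (by norm_num)
  have hi₂ : ∀ i j, Integrable (fun ω => ξ ω i * ξ ω j) P := fun i j =>
    (hξi i).integrable_mul (hξi j)
  have hiΓ : ∀ i j, Integrable (fun ω => Γ ω i j) P := fun i j =>
    integrable_condExp.congr (hΓc i j)
  set b₁ : Fin d → Ω → ℝ := fun i ω => gaussAvg (Q ω) (f₁ i) (X ω) with hb₁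
  set b₂ : Fin d → Fin d → Ω → ℝ := fun i j ω => gaussAvg (Q ω) (f₂ i j) (X ω) with hb₂
  have hb₁m : ∀ i, Measurable[m] (b₁ i) := fun i =>
    measurable_gaussAvg_comp hQm hQ hX (h.cont₁ i) (hB₁ i)
  have hb₂m : ∀ i j, Measurable[m] (b₂ i j) := fun i j =>
    measurable_gaussAvg_comp hQm hQ hX (h.cont₂ i j) (h.abs_coeff₂_le i j)
  have hb₁B : ∀ i ω, |b₁ i ω| ≤ B₁ := fun i ω => abs_gaussAvg_le _ (hB₁ i) _
  have hb₂B : ∀ i j ω, |b₂ i j ω| ≤ K₂ := fun i j ω => abs_gaussAvg_le _ (h.abs_coeff₂_le i j) _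
  have I₁ : ∀ i, Integrable (fun ω => b₁ i ω * ξ ω i) P := fun i =>
    integrable_bdd_mul ((hb₁m i).mono hm le_rfl) (hb₁B i) (hi₁ i)
  have I₂ : ∀ i j, Integrable (fun ω => b₂ i j ω * (ξ ω i * ξ ω j)) P := fun i j =>
    integrable_bdd_mul ((hb₂m i j).mono hm le_rfl) (hb₂B i j) (hi₂ i j)
  have I₃ : ∀ i j, Integrable (fun ω => b₂ i j ω * Γ ω i j) P := fun i j =>
    integrable_bdd_mul ((hb₂m i j).mono hm le_rfl) (hb₂B i j) (hiΓ i j)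
  have S₁ : Integrable (fun ω => ∑ i, b₁ i ω * ξ ω i) P := integrable_finsetSum _ fun i _ => I₁ i
  have S₂ : Integrable (fun ω => ∑ i, ∑ j, b₂ i j ω * (ξ ω i * ξ ω j)) P :=
    integrable_finsetSum _ fun i _ => integrable_finsetSum _ fun j _ => I₂ i j
  have S₃ : Integrable (fun ω => ∑ i, ∑ j, b₂ i j ω * Γ ω i j) P :=
    integrable_finsetSum _ fun i _ => integrable_finsetSum _ fun j _ => I₃ i j
  have J : ∀ {R : Ω → Matrix (Fin d) (Fin d) ℝ} {Y : Ω → Fin d → ℝ},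
      (∀ i j, Measurable fun ω => R ω i j) → (∀ ω, (R ω).PosSemidef) → Measurable Y →
      Integrable (fun ω => gaussAvg (R ω) f (Y ω)) P := fun hR hR' hY =>
    Integrable.of_bound (measurable_gaussAvg_comp hR hR' hY h.cont hB).aestronglyMeasurable B
      (ae_of_all _ fun ω => abs_gaussAvg_le _ hB _)
  have J₁ := J hQmΩ hQ ((hX.mono hm le_rfl).add hξm)
  have J₂ := J (fun i j => (hQm' i j).mono hm le_rfl) hQ' (hX.mono hm le_rfl)
  simp only [Pi.add_apply] at J₁
  -- The linear term vanishes because the increment is conditionally centered; next, the quadratic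
  -- terms match because `Γ` is the conditional covariance.
  have E₁ : ∫ ω in G, ∑ i, b₁ i ω * ξ ω i ∂P = 0 := by
    rw [integral_finsetSum _ fun i _ => (I₁ i).integrableOn]
    refine Finset.sum_eq_zero fun i _ => ?_
    rw [setIntegral_mul_eq_setIntegral_mul_condExp hm hG (hb₁m i) (hb₁B i) (hi₁ i) (hξ0 i)]
    simp
  have E₂ : ∫ ω in G, ∑ i, ∑ j, b₂ i j ω * (ξ ω i * ξ ω j) ∂P =
      ∫ ω in G, ∑ i, ∑ j, b₂ i j ω * Γ ω i j ∂P := by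
    rw [integral_finsetSum _ fun i _ => integrable_finsetSum _ fun j _ => (I₂ i j).integrableOn,
      integral_finsetSum _ fun i _ => integrable_finsetSum _ fun j _ => (I₃ i j).integrableOn]
    refine Finset.sum_congr rfl fun i _ => ?_
    rw [integral_finsetSum _ fun j _ => (I₂ i j).integrableOn,
      integral_finsetSum _ fun j _ => (I₃ i j).integrableOn]
    exact Finset.sum_congr rfl fun j _ => setIntegral_mul_eq_setIntegral_mul_condExp hm hG
      (hb₂m i j) (hb₂B i j) (hi₂ i j) (hΓc i j)
  have T : Integrable (fun ω => K₃ * (‖ξ ω‖ ^ 3 + c ω)) P := (hξ3.add hc).const_mul _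
  have key : ∀ᵐ ω ∂P.restrict G, gaussAvg (Q ω) f (X ω + ξ ω) ≤ gaussAvg (Q' ω) f (X ω) +
      ∑ i, b₁ i ω * ξ ω i + (∑ i, ∑ j, b₂ i j ω * (ξ ω i * ξ ω j) - ∑ i, ∑ j, b₂ i j ω * Γ ω i j) +
      K₃ * (‖ξ ω‖ ^ 3 + c ω) := by
    rw [ae_restrict_iff' (hm _ hG)]
    filter_upwards [hΓ, hΓ3] with ω h₁ h₂ hω
    have hs := h.smoothed (Q ω)
    have t₁ := (abs_le.1 (hs.taylor (X ω) (ξ ω))).2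
    have t₂ := (abs_le.1 (hs.abs_gaussAvg_sub_sub_le h₁ (X ω))).1
    -- Averaging the smoothed function `gaussAvg (Q ω) f` over `N(0, Γ ω)` gives the average with
    -- covariance `Q' ω`, by the semigroup property.
    rw [← gaussAvg_add h₁ (hQ ω) h.cont hB, add_comm, ← hQQ' ω hω] at t₂
    have t₃ := mul_le_mul_of_nonneg_left h₂ hK₃
    simp only [hb₁, hb₂]
    linarith
  refine (integral_mono_ae J₁.integrableOn (((J₂.add S₁).add (S₂.sub S₃)).add T).integrableOn
    key).trans ?_
  have e : ∫ ω in G, (gaussAvg (Q' ω) f (X ω) + ∑ i, b₁ i ω * ξ ω i +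
      (∑ i, ∑ j, b₂ i j ω * (ξ ω i * ξ ω j) - ∑ i, ∑ j, b₂ i j ω * Γ ω i j) +
      K₃ * (‖ξ ω‖ ^ 3 + c ω)) ∂P = ∫ ω in G, gaussAvg (Q' ω) f (X ω) ∂P +
      ∫ ω in G, K₃ * (‖ξ ω‖ ^ 3 + c ω) ∂P := by
    rw [integral_add (by exact ((J₂.add S₁).add (S₂.sub S₃)).integrableOn) T.integrableOn,
      integral_add (by exact (J₂.add S₁).integrableOn) (by exact (S₂.sub S₃).integrableOn),
      integral_add J₂.integrableOn S₁.integrableOn,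
      integral_sub S₂.integrableOn S₃.integrableOn, E₁, E₂]
    ring
  have hT : 0 ≤ᵐ[P] fun ω => K₃ * (‖ξ ω‖ ^ 3 + c ω) := by
    filter_upwards [hΓ3] with ω hω
    have : 0 ≤ ∫ y, ‖y‖ ^ 3 ∂centeredGaussian (Γ ω) := integral_nonneg fun y => by positivity
    exact mul_nonneg hK₃ (add_nonneg (by positivity) (this.trans hω))
  refine (e.trans_le ?_)
  rw [← integral_add hξ3 hc, ← integral_const_mul]
  have := setIntegral_le_integral (s := G) T hT
  linarith

end

end

/-! ### Thinned sums and the reserve of covariance. -/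

section

variable {n d : ℕ}

lemma sum_filter_castSucc_lt_succ {α : Type*} [AddCommMonoid α] (a : Fin n → α) (t : Fin n) :
    ∑ s with s.castSucc < t.succ, a s = ∑ s with s.castSucc < t.castSucc, a s + a t := by
  have : Finset.univ.filter (fun s : Fin n => s.castSucc < t.succ) =
      insert t (Finset.univ.filter fun s : Fin n => s.castSucc < t.castSucc) := by
    ext s
    simp only [Finset.mem_filter, Finset.mem_univ, true_and, Finset.mem_insert, Fin.lt_def,
      Fin.val_castSucc, Fin.val_succ, Fin.ext_iff]
    omega
  rw [this, Finset.sum_insert (by simp), add_comm]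

lemma sum_filter_castSucc_lt_last {α : Type*} [AddCommMonoid α] (a : Fin n → α) :
    ∑ s with s.castSucc < Fin.last n, a s = ∑ s, a s := by
  rw [Finset.filter_true_of_mem fun s _ => Fin.castSucc_lt_last s]

lemma le_add_sum_of_step {a : Fin (n + 1) → ℝ} {e : Fin n → ℝ}
    (h : ∀ t : Fin n, a t.succ ≤ a t.castSucc + e t) : a (Fin.last n) ≤ a 0 + ∑ t, e t := by
  have : ∀ i, a i ≤ a 0 + ∑ s with s.castSucc < i, e s := fun i => by
    induction i using Fin.induction with
    | zero => simp
    | succ t ih =>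
      rw [sum_filter_castSucc_lt_succ]
      linarith [h t]
  rw [← sum_filter_castSucc_lt_last e]
  exact this _

open Classical in
/-- What is left of the covariance `Q₀` after successively subtracting those `Γ t` that keep the
difference positive semidefinite. -/
def residual (Q₀ : Matrix (Fin d) (Fin d) ℝ) (Γ : Fin n → Matrix (Fin d) (Fin d) ℝ) :
    Fin (n + 1) → Matrix (Fin d) (Fin d) ℝ :=
  Fin.induction Q₀ fun t R => if (R - Γ t).PosSemidef then R - Γ t else R

open Classical in
/-- The sum of the increments `ξ t` for which `Γ t` was subtracted in `residual`. -/
def thinnedSum (Q₀ : Matrix (Fin d) (Fin d) ℝ) (Γ : Fin n → Matrix (Fin d) (Fin d) ℝ)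
    (ξ : Fin n → Fin d → ℝ) : Fin (n + 1) → Fin d → ℝ :=
  Fin.induction 0 fun t X => if (residual Q₀ Γ t.castSucc - Γ t).PosSemidef then X + ξ t else X

section

variable {Q₀ : Matrix (Fin d) (Fin d) ℝ} (Γ : Fin n → Matrix (Fin d) (Fin d) ℝ)
    (ξ : Fin n → Fin d → ℝ) (t : Fin n)

lemma residual_zero : residual Q₀ Γ 0 = Q₀ := rfl

lemma thinnedSum_zero : thinnedSum Q₀ Γ ξ 0 = 0 := rfl

open Classical in
lemma residual_succ : residual Q₀ Γ t.succ =
    if (residual Q₀ Γ t.castSucc - Γ t).PosSemidef then residual Q₀ Γ t.castSucc - Γ t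
    else residual Q₀ Γ t.castSucc :=
  Fin.induction_succ _ _ _

open Classical in
lemma thinnedSum_succ : thinnedSum Q₀ Γ ξ t.succ =
    if (residual Q₀ Γ t.castSucc - Γ t).PosSemidef then thinnedSum Q₀ Γ ξ t.castSucc + ξ t
    else thinnedSum Q₀ Γ ξ t.castSucc :=
  Fin.induction_succ _ _ _

lemma posSemidef_residual (hQ₀ : Q₀.PosSemidef) (i : Fin (n + 1)) :
    (residual Q₀ Γ i).PosSemidef := by
  induction i using Fin.induction with
  | zero => exact hQ₀
  | succ t ih =>
    rw [residual_succ]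
    split_ifs with h
    exacts [h, ih]

variable {Γ}

/-- No test fails: what would remain after step `t` is `Q₀ - ∑ Γ` plus the later `Γ s`, a sum of
positive semidefinite matrices. -/
lemma residual_thinnedSum_eq (hΓ : ∀ t, (Γ t).PosSemidef) (h : (Q₀ - ∑ t, Γ t).PosSemidef)
    (i : Fin (n + 1)) :
    residual Q₀ Γ i = Q₀ - ∑ s with s.castSucc < i, Γ s ∧
      thinnedSum Q₀ Γ ξ i = ∑ s with s.castSucc < i, ξ s := by
  induction i using Fin.induction with
  | zero => simp [residual_zero, thinnedSum_zero]
  | succ t ih =>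
    have hp : (residual Q₀ Γ t.castSucc - Γ t).PosSemidef := by
      rw [ih.1, sub_sub, ← sum_filter_castSucc_lt_succ]
      have e : Q₀ - ∑ s with s.castSucc < t.succ, Γ s =
          (Q₀ - ∑ s, Γ s) + ∑ s with ¬ s.castSucc < t.succ, Γ s := by
        rw [← Finset.sum_filter_add_sum_filter_not Finset.univ fun s : Fin n =>
          s.castSucc < t.succ]
        abel
      rw [e]
      exact h.add (posSemidef_sum _ fun s _ => hΓ s)
    rw [residual_succ, thinnedSum_succ, if_pos hp, if_pos hp, ih.1, ih.2,
      sum_filter_castSucc_lt_succ, sum_filter_castSucc_lt_succ, sub_sub]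
    exact ⟨rfl, rfl⟩

lemma residual_last_eq (hΓ : ∀ t, (Γ t).PosSemidef) (h : (Q₀ - ∑ t, Γ t).PosSemidef) :
    residual Q₀ Γ (Fin.last n) = Q₀ - ∑ t, Γ t := by
  rw [(residual_thinnedSum_eq 0 hΓ h _).1, sum_filter_castSucc_lt_last]

lemma thinnedSum_last_eq (hΓ : ∀ t, (Γ t).PosSemidef) (h : (Q₀ - ∑ t, Γ t).PosSemidef) :
    thinnedSum Q₀ Γ ξ (Fin.last n) = ∑ t, ξ t := by
  rw [(residual_thinnedSum_eq ξ hΓ h _).2, sum_filter_castSucc_lt_last]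

end

section

variable {Ω : Type*} {mΩ : MeasurableSpace Ω} {P : Measure Ω}
    {ℱ : Filtration (Fin (n + 1)) mΩ} {Q₀ : Matrix (Fin d) (Fin d) ℝ}
    {Γ : Fin n → Ω → Matrix (Fin d) (Fin d) ℝ} {ξ : Fin n → Ω → Fin d → ℝ}

/-- Predictability: both the test and the subtracted matrix at step `t` are known before `ξ t` is.
The replacement step needs this in order to treat the new reserve as fixed. -/
lemma measurable_residual_succ_of_castSucc
    (hΓ : ∀ t i j, Measurable[ℱ t.castSucc] fun ω => Γ t ω i j) (t : Fin n)
    (h : ∀ i j, Measurable[ℱ t.castSucc] fun ω => residual Q₀ (Γ · ω) t.castSucc i j)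
    (i j : Fin d) : Measurable[ℱ t.castSucc] fun ω => residual Q₀ (Γ · ω) t.succ i j := by
  classical
  have hd : ∀ i j, Measurable[ℱ t.castSucc] fun ω =>
      (residual Q₀ (Γ · ω) t.castSucc - Γ t ω) i j := fun i j => (h i j).sub (hΓ t i j)
  simp only [residual_succ, apply_ite (fun M : Matrix (Fin d) (Fin d) ℝ => M i j)]
  exact Measurable.ite (measurableSet_posSemidef hd) (hd i j) (h i j)

lemma measurable_residual (hΓ : ∀ t i j, Measurable[ℱ t.castSucc] fun ω => Γ t ω i j)
    (k : Fin (n + 1)) : ∀ i j, Measurable[ℱ k] fun ω => residual Q₀ (Γ · ω) k i j := by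
  induction k using Fin.induction with
  | zero => exact fun i j => measurable_const
  | succ t ih =>
    exact fun i j => (measurable_residual_succ_of_castSucc hΓ t ih i j).mono
      (ℱ.mono t.castSucc_lt_succ.le) le_rfl

lemma measurableSet_posSemidef_residual_sub
    (hΓ : ∀ t i j, Measurable[ℱ t.castSucc] fun ω => Γ t ω i j) (t : Fin n) :
    MeasurableSet[ℱ t.castSucc]
      {ω | (residual Q₀ (Γ · ω) t.castSucc - Γ t ω).PosSemidef} :=
  measurableSet_posSemidef fun i j => (measurable_residual hΓ _ i j).sub (hΓ t i j)

lemma measurable_thinnedSum (hΓ : ∀ t i j, Measurable[ℱ t.castSucc] fun ω => Γ t ω i j)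
    (hξ : ∀ t, Measurable[ℱ t.succ] (ξ t)) (k : Fin (n + 1)) :
    Measurable[ℱ k] fun ω => thinnedSum Q₀ (Γ · ω) (ξ · ω) k := by
  classical
  induction k using Fin.induction with
  | zero => exact measurable_const
  | succ t ih =>
    have hle := ℱ.mono t.castSucc_lt_succ.le
    simp only [thinnedSum_succ]
    exact Measurable.ite (hle _ (measurableSet_posSemidef_residual_sub hΓ t))
      ((ih.mono hle le_rfl).add (hξ t)) (ih.mono hle le_rfl)

variable [IsProbabilityMeasure P]

/-- Lindeberg's replacement argument for the thinned sum. -/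
lemma HasTaylor.integral_gaussAvg_thinnedSum_le {K₂ K₃ : ℝ} {f : (Fin d → ℝ) → ℝ}
    {f₁ : Fin d → (Fin d → ℝ) → ℝ} {f₂ : Fin d → Fin d → (Fin d → ℝ) → ℝ}
    (h : HasTaylor K₂ K₃ f f₁ f₂) (hK₃ : 0 ≤ K₃) (hQ₀ : Q₀.PosSemidef) {c : Fin n → Ω → ℝ}
    (hΓm : ∀ t i j, Measurable[ℱ t.castSucc] fun ω => Γ t ω i j)
    (hΓ : ∀ t, ∀ᵐ ω ∂P, (Γ t ω).PosSemidef)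
    (hΓc : ∀ t i j, P[fun ω => ξ t ω i * ξ t ω j | ℱ t.castSucc] =ᵐ[P] fun ω => Γ t ω i j)
    (hξm : ∀ t, Measurable[ℱ t.succ] (ξ t))
    (hξ0 : ∀ t i, P[fun ω => ξ t ω i | ℱ t.castSucc] =ᵐ[P] 0) (hξ2 : ∀ t, MemLp (ξ t) 2 P)
    (hξ3 : ∀ t, Integrable (fun ω => ‖ξ t ω‖ ^ 3) P) (hc : ∀ t, Integrable (c t) P)
    (hΓ3 : ∀ t, ∀ᵐ ω ∂P, ∫ y, ‖y‖ ^ 3 ∂centeredGaussian (Γ t ω) ≤ c t ω) :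
    ∫ ω, gaussAvg (residual Q₀ (Γ · ω) (Fin.last n)) f
        (thinnedSum Q₀ (Γ · ω) (ξ · ω) (Fin.last n)) ∂P ≤
      gaussAvg Q₀ f 0 + K₃ * ∑ t, (∫ ω, ‖ξ t ω‖ ^ 3 ∂P + ∫ ω, c t ω ∂P) := by
  obtain ⟨B, hB⟩ := h.bdd
  have J : ∀ i, Integrable (fun ω => gaussAvg (residual Q₀ (Γ · ω) i) f
      (thinnedSum Q₀ (Γ · ω) (ξ · ω) i)) P := fun i =>
    Integrable.of_bound (measurable_gaussAvg_comp
      (fun a b => (measurable_residual hΓm i a b).mono (ℱ.le i) le_rfl)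
      (fun ω => posSemidef_residual _ hQ₀ i)
      ((measurable_thinnedSum hΓm hξm i).mono (ℱ.le i) le_rfl) h.cont hB).aestronglyMeasurable B
      (ae_of_all _ fun ω => abs_gaussAvg_le _ hB _)
  have := le_add_sum_of_step
    (a := fun i => ∫ ω, gaussAvg (residual Q₀ (Γ · ω) i) f
      (thinnedSum Q₀ (Γ · ω) (ξ · ω) i) ∂P)
    (e := fun t => K₃ * (∫ ω, ‖ξ t ω‖ ^ 3 ∂P + ∫ ω, c t ω ∂P)) (fun t => by
      have hG := measurableSet_posSemidef_residual_sub (Q₀ := Q₀) hΓm t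
      set G := {ω | (residual Q₀ (Γ · ω) t.castSucc - Γ t ω).PosSemidef} 
      have hG' := ℱ.le _ _ hG
      have hGmem : ∀ ω, ω ∈ G ↔ (residual Q₀ (Γ · ω) t.castSucc - Γ t ω).PosSemidef :=
        fun ω => Iff.rfl
      -- On `G` the increment is exchanged for a Gaussian; off `G` the state does not change and
      -- nothing is paid.
      rw [← integral_add_compl hG' (J t.succ), ← integral_add_compl hG' (J t.castSucc)]
      have e₁ : ∫ ω in G, gaussAvg (residual Q₀ (Γ · ω) t.succ) f
          (thinnedSum Q₀ (Γ · ω) (ξ · ω) t.succ) ∂P =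
          ∫ ω in G, gaussAvg (residual Q₀ (Γ · ω) t.succ) f
          (thinnedSum Q₀ (Γ · ω) (ξ · ω) t.castSucc + ξ t ω) ∂P :=
        setIntegral_congr_fun hG' fun ω hω => by
          simp only [thinnedSum_succ]
          rw [if_pos ((hGmem ω).1 hω)]
      have e₂ : ∫ ω in Gᶜ, gaussAvg (residual Q₀ (Γ · ω) t.succ) f
          (thinnedSum Q₀ (Γ · ω) (ξ · ω) t.succ) ∂P =
          ∫ ω in Gᶜ, gaussAvg (residual Q₀ (Γ · ω) t.castSucc) f
          (thinnedSum Q₀ (Γ · ω) (ξ · ω) t.castSucc) ∂P :=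
        setIntegral_congr_fun hG'.compl fun ω hω => by
          simp only [thinnedSum_succ, residual_succ]
          rw [if_neg (mt (hGmem ω).2 hω), if_neg (mt (hGmem ω).2 hω)]
      rw [e₁, e₂]
      have step := h.setIntegral_gaussAvg_add_le (P := P) (ℱ.le t.castSucc) hG
        (measurable_thinnedSum (Q₀ := Q₀) hΓm hξm t.castSucc)
        (measurable_residual_succ_of_castSucc (Q₀ := Q₀) hΓm t (measurable_residual hΓm _))
        (fun ω => posSemidef_residual _ hQ₀ t.succ)
        (measurable_residual (Q₀ := Q₀) hΓm t.castSucc)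
        (fun ω => posSemidef_residual _ hQ₀ t.castSucc)
        (fun ω hω => by rw [residual_succ, if_pos ((hGmem ω).1 hω), sub_add_cancel]) (hΓ t) (hΓc t)
        ((hξm t).mono (ℱ.le _) le_rfl) (hξ0 t) (hξ2 t) (hξ3 t) (hc t) (hΓ3 t) hK₃
      linarith)
  rw [← Finset.mul_sum] at this
  simpa [residual_zero, thinnedSum_zero] using this

end

end

/-! ### The martingale: conditional covariances, third moments and comparison with `N(0, V)`. -/

section

variable {n d : ℕ} {Ω : Type*} {mΩ : MeasurableSpace Ω} {P : Measure Ω}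
  {ℱ : Filtration (Fin (n + 1)) mΩ} {M : Fin (n + 1) → Ω → Fin d → ℝ}

section Martingale

lemma IsMartingaleFromZero.measurable_increment (hM : IsMartingaleFromZero P ℱ M) (t : Fin n) :
    Measurable[ℱ t.succ] (increment M t) :=
  (hM.martingale.1 t.succ).measurable.sub
    ((hM.martingale.1 t.castSucc).measurable.mono (ℱ.mono t.castSucc_lt_succ.le) le_rfl)

lemma IsMartingaleFromZero.memLp_increment (hM : IsMartingaleFromZero P ℱ M) (t : Fin n) :
    MemLp (increment M t) 2 P :=
  (hM.memLp_two t.succ).sub (hM.memLp_two t.castSucc)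

lemma IsMartingaleFromZero.condExp_increment [IsProbabilityMeasure P]
    (hM : IsMartingaleFromZero P ℱ M) (t : Fin n) (i : Fin d) :
    P[fun ω => increment M t ω i | ℱ t.castSucc] =ᵐ[P] 0 := by
  have hi : ∀ k, Integrable (M k) P := fun k => (hM.memLp_two k).integrable (by norm_num)
  have h₁ : P[increment M t | ℱ t.castSucc] =ᵐ[P] 0 := by
    have hs := condExp_sub (hi t.succ) (hi t.castSucc) (ℱ t.castSucc)
    have hp := hM.martingale.2 t.castSucc t.succ t.castSucc_lt_succ.le
    have hc := hM.martingale.2 t.castSucc t.castSucc le_rfl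
    filter_upwards [hs, hp, hc] with ω a b c
    change (P[M t.succ - M t.castSucc | ℱ t.castSucc]) ω = 0
    rw [a, Pi.sub_apply, b, c, sub_self]
  have h₂ := (ContinuousLinearMap.proj (R := ℝ) (φ := fun _ : Fin d => ℝ) i).comp_condExp_comm
    (m := ℱ t.castSucc) ((hM.memLp_increment t).integrable (by norm_num))
  filter_upwards [h₁, h₂] with ω a b
  refine b.symm.trans ?_
  rw [Function.comp_apply, a]
  rfl

lemma measurable_condCov (t : Fin n) (i j : Fin d) :
    Measurable[ℱ t.castSucc] fun ω => condCov P ℱ M t ω i j :=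
  stronglyMeasurable_condExp.measurable

lemma integrable_condCov (t : Fin n) (i j : Fin d) :
    Integrable (fun ω => condCov P ℱ M t ω i j) P :=
  integrable_condExp

lemma quadVar_apply (ω : Ω) (i j : Fin d) :
    quadVar P ℱ M ω i j = ∑ t, condCov P ℱ M t ω i j := by
  rw [quadVar, Matrix.sum_apply]

lemma integrable_entryNorm_sub_quadVar [IsProbabilityMeasure P] (V : Matrix (Fin d) (Fin d) ℝ) :
    Integrable (fun ω => entryNorm (V - quadVar P ℱ M ω)) P := by
  refine Integrable.norm (f := fun ω => (fun i j => (V - quadVar P ℱ M ω) i j : Fin d → Fin d → ℝ))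
    (Integrable.of_eval fun i => Integrable.of_eval fun j => ?_)
  simp only [Matrix.sub_apply, quadVar_apply]
  exact (integrable_const _).sub (integrable_finsetSum _ fun t _ => integrable_condCov t i j)

lemma measurableSet_posSemidef_sub_quadVar (Q : Matrix (Fin d) (Fin d) ℝ) :
    MeasurableSet {ω | (Q - quadVar P ℱ M ω).PosSemidef} := by
  refine measurableSet_posSemidef fun i j => ?_
  simp only [Matrix.sub_apply, quadVar_apply]
  exact measurable_const.sub (Finset.measurable_sum _ fun t _ =>
    (measurable_condCov t i j).mono (ℱ.le _) le_rfl)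

end Martingale

section ThirdMoments

lemma integrable_norm_pow_three_of_lintegral_ne_top {Z : Ω → Fin d → ℝ} (hZ : Measurable Z)
    (h : ∫⁻ ω, ‖Z ω‖ₑ ^ 3 ∂P ≠ ∞) : Integrable (fun ω => ‖Z ω‖ ^ 3) P := by
  refine ⟨(hZ.norm.pow_const 3).aestronglyMeasurable, ?_⟩
  rw [hasFiniteIntegral_iff_enorm]
  simpa only [enorm_pow, enorm_norm] using h.lt_top

lemma ofReal_integral_norm_pow_three {Z : Ω → Fin d → ℝ}
    (h : Integrable (fun ω => ‖Z ω‖ ^ 3) P) :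
    ENNReal.ofReal (∫ ω, ‖Z ω‖ ^ 3 ∂P) = ∫⁻ ω, ‖Z ω‖ₑ ^ 3 ∂P := by
  have := ofReal_integral_norm_eq_lintegral_enorm h
  simpa only [enorm_pow, enorm_norm, norm_pow, norm_norm] using this

/-- If the third moments are finite, they are computed by Bochner integrals. -/
lemma thirdMoments_eq_ofReal {ξ η : Fin n → Ω → Fin d → ℝ} (hξ : ∀ t, Measurable (ξ t))
    (hη : ∀ t, Measurable (η t)) (h : thirdMoments P ξ η ≠ ∞) :
    (∀ t, Integrable (fun ω => ‖ξ t ω‖ ^ 3) P) ∧ (∀ t, Integrable (fun ω => ‖η t ω‖ ^ 3) P) ∧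
      thirdMoments P ξ η =
        ENNReal.ofReal (∑ t, (∫ ω, ‖ξ t ω‖ ^ 3 ∂P + ∫ ω, ‖η t ω‖ ^ 3 ∂P)) := by
  have e : ∀ t, ∫⁻ ω, (‖ξ t ω‖ₑ ^ 3 + ‖η t ω‖ₑ ^ 3) ∂P =
      ∫⁻ ω, ‖ξ t ω‖ₑ ^ 3 ∂P + ∫⁻ ω, ‖η t ω‖ₑ ^ 3 ∂P := fun t =>
    lintegral_add_left ((hξ t).enorm.pow_const 3) _
  have h' := ENNReal.sum_ne_top.1 h
  simp only [e, ENNReal.add_ne_top, Finset.mem_univ, true_imp_iff] at h'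
  have i₁ := fun t => integrable_norm_pow_three_of_lintegral_ne_top (hξ t) (h' t).1
  have i₂ := fun t => integrable_norm_pow_three_of_lintegral_ne_top (hη t) (h' t).2
  have n₁ : ∀ t, 0 ≤ ∫ ω, ‖ξ t ω‖ ^ 3 ∂P := fun t => integral_nonneg fun ω => by positivity
  have n₂ : ∀ t, 0 ≤ ∫ ω, ‖η t ω‖ ^ 3 ∂P := fun t => integral_nonneg fun ω => by positivity
  refine ⟨i₁, i₂, ?_⟩
  rw [thirdMoments, ENNReal.ofReal_sum_of_nonneg fun t _ => add_nonneg (n₁ t) (n₂ t)]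
  refine Finset.sum_congr rfl fun t _ => ?_
  rw [e, ENNReal.ofReal_add (n₁ t) (n₂ t), ofReal_integral_norm_pow_three (i₁ t),
    ofReal_integral_norm_pow_three (i₂ t)]

variable {S : Fin n → Ω → Matrix (Fin d) (Fin d) ℝ} {N : Fin n → Ω → Fin d → ℝ}

lemma IsSqrtCondCov.measurable_gaussIncrement (hS : IsSqrtCondCov P ℱ M S)
    (hN : ∀ t, Measurable (N t)) (t : Fin n) : Measurable (gaussIncrement S N t) := by
  refine measurable_pi_iff.2 fun i => ?_
  simp only [gaussIncrement, Matrix.mulVec, dotProduct]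
  exact Finset.measurable_sum _ fun j _ =>
    ((hS.measurable t i j).mono (ℱ.le _) le_rfl).mul ((measurable_pi_apply j).comp (hN t))

lemma IsSqrtCondCov.posSemidef_condCov (hS : IsSqrtCondCov P ℱ M S) (t : Fin n) :
    ∀ᵐ ω ∂P, (condCov P ℱ M t ω).PosSemidef := by
  filter_upwards [hS.mul_transpose t] with ω hω
  rw [← hω]
  simpa [conjTranspose_eq_transpose_of_trivial] using posSemidef_self_mul_conjTranspose (S t ω)

/-- The conditional third moment of `S_t N_t`. -/
def condThirdMoment (S : Fin n → Ω → Matrix (Fin d) (Fin d) ℝ) (t : Fin n) (ω : Ω) : ℝ :=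
  ∫ z, ‖(S t ω).mulVec z‖ ^ 3 ∂Measure.pi fun _ : Fin d => gaussianReal 0 1

lemma IsSqrtCondCov.integral_norm_pow_three_condCov (hS : IsSqrtCondCov P ℱ M S) (t : Fin n) :
    ∀ᵐ ω ∂P, ∫ y, ‖y‖ ^ 3 ∂centeredGaussian (condCov P ℱ M t ω) = condThirdMoment S t ω := by
  filter_upwards [hS.mul_transpose t] with ω hω
  rw [← hω, ← map_mulVec_pi_gaussianReal, integral_map (by fun_prop)
    (Measurable.aestronglyMeasurable (by fun_prop))]
  rfl

/-- `S t` is measurable with respect to the final `σ`-algebra, of which `N t` is independent. Hence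
their joint law is a product, and Fubini's theorem integrates out the noise. -/
lemma integrable_condThirdMoment [IsProbabilityMeasure P] (hS : IsSqrtCondCov P ℱ M S)
    (hN : IsStdGaussianNoise (ℱ (Fin.last n)) P N) (t : Fin n)
    (hη : Integrable (fun ω => ‖gaussIncrement S N t ω‖ ^ 3) P) :
    Integrable (condThirdMoment S t) P ∧
      ∫ ω, condThirdMoment S t ω ∂P = ∫ ω, ‖gaussIncrement S N t ω‖ ^ 3 ∂P := by
  let s : Ω → Fin d → Fin d → ℝ := fun ω i j => S t ω i j
  have hs : Measurable[ℱ (Fin.last n)] s := @measurable_pi_lambda _ _ _ (ℱ (Fin.last n)) _ _ fun i =>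
    @measurable_pi_lambda _ _ _ (ℱ (Fin.last n)) _ _ fun j => (hS.measurable t i j).mono (ℱ.mono (Fin.le_last _)) le_rfl
  have hs' : Measurable s := hs.mono (ℱ.le _) le_rfl
  have hind : IndepFun s (N t) P := by
    refine (IndepFun_iff_Indep _ _ _).2 (Indep.symm ?_)
    refine indep_of_indep_of_le_left (indep_of_indep_of_le_right hN.indep hs.comap_le) ?_
    exact ((measurable_pi_apply t).comp (comap_measurable fun ω t => N t ω)).comap_le
  have hmap := (indepFun_iff_map_prod_eq_prod_map_map hs'.aemeasurable
    (hN.measurable t).aemeasurable).1 hind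
  rw [hN.map_eq t] at hmap
  let φ : (Fin d → Fin d → ℝ) × (Fin d → ℝ) → ℝ := fun p => ‖(Matrix.of p.1).mulVec p.2‖ ^ 3
  have hφ : Continuous φ := by
    have : Continuous fun p : (Fin d → Fin d → ℝ) × (Fin d → ℝ) =>
      (Matrix.of p.1 : Matrix (Fin d) (Fin d) ℝ) := continuous_fst
    fun_prop
  have hsN : Measurable fun ω => (s ω, N t ω) := hs'.prodMk (hN.measurable t)
  have := Measure.isProbabilityMeasure_map (μ := P) hs'.aemeasurable
  have hint : Integrable φ ((P.map s).prod (Measure.pi fun _ => gaussianReal 0 1)) := by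
    rw [← hmap, integrable_map_measure hφ.aestronglyMeasurable hsN.aemeasurable]
    exact hη
  constructor
  · exact (integrable_map_measure hint.integral_prod_left.aestronglyMeasurable
      hs'.aemeasurable).1 hint.integral_prod_left
  · have h₁ := integral_prod φ hint
    rw [← hmap, integral_map hsN.aemeasurable hφ.aestronglyMeasurable,
      integral_map hs'.aemeasurable hint.integral_prod_left.aestronglyMeasurable] at h₁
    exact h₁.symm

end ThirdMoments

/-- At `Q = 0` the smoothing error is a multiple of the third moment of `N(0, 0)`, which vanishes by
scaling with `c = 0`. -/
lemma gaussAvg_zero {K₂ K₃ : ℝ} {f : (Fin d → ℝ) → ℝ} {f₁ : Fin d → (Fin d → ℝ) → ℝ}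
    {f₂ : Fin d → Fin d → (Fin d → ℝ) → ℝ} (h : HasTaylor K₂ K₃ f f₁ f₂) (x : Fin d → ℝ) :
    gaussAvg 0 f x = f x := by
  have h₀ := h.abs_gaussAvg_sub_sub_le PosSemidef.zero x
  have h₁ := integral_norm_pow_three_sq_smul 0 (PosSemidef.zero (n := Fin d) (R := ℝ))
  simp only [smul_zero] at h₁
  rw [h₁] at h₀
  simpa [sub_eq_zero] using h₀

lemma gaussAvg_nonneg {f : (Fin d → ℝ) → ℝ} (hf : ∀ x, 0 ≤ f x) (Q : Matrix (Fin d) (Fin d) ℝ)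
    (x : Fin d → ℝ) : 0 ≤ gaussAvg Q f x :=
  integral_nonneg fun _ => hf _

lemma measurable_maxCoord : Measurable (maxCoord : (Fin d → ℝ) → ℝ) :=
  Measurable.iSup fun i => measurable_pi_apply i

lemma entryNorm_residual_le (V U W : Matrix (Fin d) (Fin d) ℝ) :
    entryNorm (V + U - W) ≤ entryNorm U + entryNorm (V - W) := by
  rw [show V + U - W = U + (V - W) by abel]
  exact entryNorm_add_le _ _

lemma deltaN_nonneg (V Vδ : Matrix (Fin d) (Fin d) ℝ) : 0 ≤ deltaN P ℱ M V Vδ :=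
  add_nonneg (entryNorm_nonneg _) (integral_nonneg fun _ => entryNorm_nonneg _)

/-- The comparison of the maximum of the martingale with a smooth function of `N(0, V)`. -/
lemma HasTaylor.measureReal_maxCoord_le [IsProbabilityMeasure P] {K₂ K₃ : ℝ}
    {f : (Fin d → ℝ) → ℝ} {f₁ : Fin d → (Fin d → ℝ) → ℝ} {f₂ : Fin d → Fin d → (Fin d → ℝ) → ℝ}
    (h : HasTaylor K₂ K₃ f f₁ f₂) (hK₃ : 0 ≤ K₃) (hf0 : ∀ x, 0 ≤ f x)
    {A : Set ℝ} (hA : MeasurableSet A) (hfA : ∀ x, maxCoord x ∈ A → f x = 1)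
    (hM : IsMartingaleFromZero P ℱ M) {S : Fin n → Ω → Matrix (Fin d) (Fin d) ℝ}
    {N : Fin n → Ω → Fin d → ℝ} (hS : IsSqrtCondCov P ℱ M S)
    (hN : IsStdGaussianNoise (ℱ (Fin.last n)) P N)
    (hξ3 : ∀ t, Integrable (fun ω => ‖increment M t ω‖ ^ 3) P)
    (hη3 : ∀ t, Integrable (fun ω => ‖gaussIncrement S N t ω‖ ^ 3) P)
    {V Vδ : Matrix (Fin d) (Fin d) ℝ} (hV : V.PosSemidef) (hVδ : Vδ.PosSemidef) :
    P.real {ω | maxCoord (∑ t, increment M t ω) ∈ A} ≤ gaussAvg V f 0 +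
      (1 - P.real {ω | (V + Vδ - quadVar P ℱ M ω).PosSemidef}) +
      2 * K₂ * deltaN P ℱ M V Vδ +
      K₃ * ∑ t, (∫ ω, ‖increment M t ω‖ ^ 3 ∂P + ∫ ω, ‖gaussIncrement S N t ω‖ ^ 3 ∂P) := by
  obtain ⟨B, hB⟩ := h.bdd
  have hK₂ : 0 ≤ K₂ :=
    (Finset.sum_nonneg fun i _ => Finset.sum_nonneg fun j _ => abs_nonneg _).trans (h.bdd₂ 0)
  have hQ₀ : (V + Vδ).PosSemidef := hV.add hVδ
  set Γ : Fin n → Ω → Matrix (Fin d) (Fin d) ℝ := condCov P ℱ M 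
  set ξ : Fin n → Ω → Fin d → ℝ := increment M 
  have hΓm : ∀ t i j, Measurable[ℱ t.castSucc] fun ω => Γ t ω i j := measurable_condCov
  have hξm := hM.measurable_increment
  have hc := fun t => integrable_condThirdMoment hS hN t (hη3 t)
  have hL := h.integral_gaussAvg_thinnedSum_le (Q₀ := V + Vδ) hK₃ hQ₀ hΓm
    hS.posSemidef_condCov (fun t i j => ae_of_all _ fun ω => rfl) hξm hM.condExp_increment
    hM.memLp_increment hξ3 (fun t => (hc t).1)
    (fun t => (hS.integral_norm_pow_three_condCov t).mono fun ω hω => hω.le)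
  simp only [fun t => (hc t).2] at hL
  set g : Ω → ℝ := fun ω => gaussAvg (residual (V + Vδ) (Γ · ω) (Fin.last n)) f
    (thinnedSum (V + Vδ) (Γ · ω) (ξ · ω) (Fin.last n)) with hg
  have hgi : Integrable g P :=
    Integrable.of_bound (measurable_gaussAvg_comp
      (fun a b => (measurable_residual hΓm _ a b).mono (ℱ.le _) le_rfl)
      (fun ω => posSemidef_residual _ hQ₀ _)
      ((measurable_thinnedSum hΓm hξm _).mono (ℱ.le _) le_rfl) h.cont hB).aestronglyMeasurable B
      (ae_of_all _ fun ω => abs_gaussAvg_le _ hB _)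
  set Gd : Set Ω := {ω | (V + Vδ - quadVar P ℱ M ω).PosSemidef} with hGd
  have hGdm : MeasurableSet Gd := measurableSet_posSemidef_sub_quadVar _
  set Z : Set Ω := {ω | maxCoord (∑ t, ξ t ω) ∈ A} with hZ
  have hZm : MeasurableSet Z := by
    have : Measurable fun ω => ∑ t, ξ t ω :=
      Finset.measurable_sum _ fun t _ => (hξm t).mono (ℱ.le _) le_rfl
    exact (measurable_maxCoord.comp this) hA
  have hi₁ : Integrable (Z.indicator fun _ => (1 : ℝ)) P := (integrable_const _).indicator hZm
  have hi₂ : Integrable (Gdᶜ.indicator fun _ => (1 : ℝ)) P :=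
    (integrable_const _).indicator hGdm.compl
  have hi₃ : Integrable (fun ω => K₂ * (entryNorm Vδ + entryNorm (V - quadVar P ℱ M ω))) P :=
    ((integrable_const _).add (integrable_entryNorm_sub_quadVar V)).const_mul _
  have hpt : ∀ᵐ ω ∂P, Z.indicator (fun _ => (1 : ℝ)) ω ≤ g ω + Gdᶜ.indicator (fun _ => 1) ω +
      K₂ * (entryNorm Vδ + entryNorm (V - quadVar P ℱ M ω)) := by
    filter_upwards [ae_all_iff.2 hS.posSemidef_condCov] with ω hω
    have hg0 : 0 ≤ g ω := gaussAvg_nonneg hf0 _ _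
    have hn : 0 ≤ K₂ * (entryNorm Vδ + entryNorm (V - quadVar P ℱ M ω)) :=
      mul_nonneg hK₂ (add_nonneg (entryNorm_nonneg _) (entryNorm_nonneg _))
    by_cases hG : ω ∈ Gd
    · have hp : (V + Vδ - ∑ t, Γ t ω).PosSemidef := hG
      have eg : g ω = gaussAvg (V + Vδ - quadVar P ℱ M ω) f (∑ t, ξ t ω) := by
        simp only [hg]
        rw [residual_last_eq hω hp, thinnedSum_last_eq _ hω hp]
        rfl
      -- Comparison with covariance `0` drops the unused reserve: this is the first `K₂ * deltaN`.
      have hcmp := h.abs_gaussAvg_sub_gaussAvg_le (Q := V + Vδ - quadVar P ℱ M ω) hp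
        PosSemidef.zero (∑ t, ξ t ω)
      rw [gaussAvg_zero h, sub_zero, ← eg] at hcmp
      have hb := mul_le_mul_of_nonneg_left (entryNorm_residual_le V Vδ (quadVar P ℱ M ω)) hK₂
      have hfZ : Z.indicator (fun _ => (1 : ℝ)) ω ≤ f (∑ t, ξ t ω) := by
        by_cases hz : ω ∈ Z
        · rw [Set.indicator_of_mem hz, hfA _ hz]
        · rw [Set.indicator_of_notMem hz]
          exact hf0 _
      have hi0 : Gdᶜ.indicator (fun _ => (1 : ℝ)) ω = 0 :=
        Set.indicator_of_notMem (Set.notMem_compl_iff.2 hG) _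
      linarith [(abs_le.1 hcmp).1]
    · rw [Set.indicator_of_mem (show ω ∈ Gdᶜ from hG)]
      have : Z.indicator (fun _ => (1 : ℝ)) ω ≤ 1 :=
        Set.indicator_le_self' (fun _ _ => zero_le_one) ω
      linarith
  have hint := integral_mono_ae hi₁ ((hgi.add hi₂).add hi₃) hpt
  have e₃ : ∫ ω, K₂ * (entryNorm Vδ + entryNorm (V - quadVar P ℱ M ω)) ∂P =
      K₂ * deltaN P ℱ M V Vδ := by
    rw [integral_const_mul, integral_add (integrable_const _) (integrable_entryNorm_sub_quadVar V)]
    simp [deltaN]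
  have e₂ : ∫ ω, Gdᶜ.indicator (fun _ => (1 : ℝ)) ω ∂P = 1 - P.real Gd := by
    rw [integral_indicator_const _ hGdm.compl, probReal_compl_eq_one_sub hGdm]
    simp
  have e₁ : ∫ ω, Z.indicator (fun _ => (1 : ℝ)) ω ∂P = P.real Z := by
    rw [integral_indicator_const _ hZm]
    simp
  have eR : ∫ ω, (g ω + Gdᶜ.indicator (fun _ => 1) ω +
      K₂ * (entryNorm Vδ + entryNorm (V - quadVar P ℱ M ω))) ∂P =
      ∫ ω, g ω ∂P + (1 - P.real Gd) + K₂ * deltaN P ℱ M V Vδ := by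
    rw [integral_add (by exact hgi.add hi₂) hi₃, integral_add hgi hi₂, e₂, e₃]
  rw [e₁] at hint
  have hint' := hint.trans_eq eR
  -- The second `K₂ * deltaN`: the replacement started from `V + Vδ` instead of `V`.
  have hVV := h.abs_gaussAvg_sub_gaussAvg_le hQ₀ hV 0
  rw [add_sub_cancel_left] at hVV
  have hΔ : entryNorm Vδ ≤ deltaN P ℱ M V Vδ :=
    le_add_of_nonneg_right (integral_nonneg fun _ => entryNorm_nonneg _)
  have hKΔ := mul_le_mul_of_nonneg_left hΔ hK₂
  linarith [(abs_le.1 hVV).2]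

end

/-! ### From Gaussian averages to probabilities and to the bootstrap covariance. -/

section

variable {n d : ℕ}

lemma measurableSet_maxCoord_mem {T : Set ℝ} (hT : MeasurableSet T) :
    MeasurableSet {y : EuclideanSpace ℝ (Fin d) | maxCoord (fun j => y j) ∈ T} :=
  (measurable_maxCoord.comp measurable_ofLp_euclidean) hT

lemma gaussAvg_le_multivariateGaussian_real {f : (Fin d → ℝ) → ℝ} (hf : Continuous f)
    (hf1 : ∀ x, f x ≤ 1) {T : Set ℝ} (hT : MeasurableSet T)
    (hfT : ∀ x, maxCoord x ∉ T → f x = 0) {B : ℝ} (hB : ∀ x, |f x| ≤ B)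
    (Q : Matrix (Fin d) (Fin d) ℝ) :
    gaussAvg Q f 0 ≤ (multivariateGaussian 0 Q).real
      {y : EuclideanSpace ℝ (Fin d) | maxCoord (fun j => y j) ∈ T} := by
  have e := integral_indicator_const (μ := multivariateGaussian 0 Q) (1 : ℝ)
    (measurableSet_maxCoord_mem (d := d) hT)
  rw [smul_eq_mul, mul_one] at e
  rw [gaussAvg_eq_integral_multivariateGaussian Q hf, ← e, WithLp.toLp_zero]
  refine integral_mono (Integrable.of_bound (by fun_prop :
    Continuous fun y : EuclideanSpace ℝ (Fin d) => f (WithLp.ofLp y)).aestronglyMeasurable B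
    (ae_of_all _ fun y => hB _)) ((integrable_const _).indicator (measurableSet_maxCoord_mem hT))
    fun y => ?_
  by_cases hy : maxCoord (fun j => y j) ∈ T
  · rw [Set.indicator_of_mem (by exact hy)]
    exact hf1 _
  · rw [Set.indicator_of_notMem (by exact hy)]
    exact (hfT _ hy).le

variable {Ω : Type*} {mΩ : MeasurableSpace Ω} {P : Measure Ω} [IsProbabilityMeasure P]

/-- A Gaussian average of a smooth function below the indicator of an event is a lower bound for
the conditional probability of the event given the random covariance. -/
lemma IsCondGaussian.gaussAvg_le_condExp {𝒢 : MeasurableSpace Ω}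
    {W : Ω → Matrix (Fin d) (Fin d) ℝ} {X : Ω → EuclideanSpace ℝ (Fin d)}
    (hX : IsCondGaussian 𝒢 P W X) {f : (Fin d → ℝ) → ℝ} (hf : Continuous f) {B : ℝ}
    (hB : ∀ x, |f x| ≤ B) {E : Set (EuclideanSpace ℝ (Fin d))} (hE : MeasurableSet E)
    (hfE : ∀ Q : Matrix (Fin d) (Fin d) ℝ, gaussAvg Q f 0 ≤ (multivariateGaussian 0 Q).real E) :
    ∀ᵐ ω ∂P, gaussAvg (W ω) f 0 ≤ (P⟦X ⁻¹' E | sigmaOf W⟧) ω := by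
  classical
  have hW𝒢 : sigmaOf W ≤ 𝒢 := Measurable.comap_le
    (@measurable_pi_lambda _ _ _ 𝒢 _ _ fun i => @measurable_pi_lambda _ _ _ 𝒢 _ _ fun j =>
      hX.measurable_cov i j)
  have hWm : ∀ i j, Measurable[sigmaOf W] fun ω => W ω i j := fun i j =>
    (measurable_pi_apply j).comp ((measurable_pi_apply i).comp
      (comap_measurable fun ω (i j : Fin d) => W ω i j))
  -- `W` is positive semidefinite only almost surely, while measurability of the average needs it
  -- everywhere.
  let W' : Ω → Matrix (Fin d) (Fin d) ℝ := fun ω => if (W ω).PosSemidef then W ω else 0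
  have hW' : ∀ ω, (W' ω).PosSemidef := fun ω => by
    simp only [W']
    split_ifs with h
    exacts [h, PosSemidef.zero]
  have hW'm : ∀ i j, Measurable[sigmaOf W] fun ω => W' ω i j := fun i j => by
    simp only [W', apply_ite (fun M : Matrix (Fin d) (Fin d) ℝ => M i j)]
    exact Measurable.ite (measurableSet_posSemidef hWm) (hWm i j) measurable_const
  have hG : Measurable[sigmaOf W] fun ω => gaussAvg (W' ω) f 0 :=
    measurable_gaussAvg_comp hW'm hW' measurable_const hf hB
  have hle : sigmaOf W ≤ mΩ := hW𝒢.trans hX.le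
  have hGi : Integrable (fun ω => gaussAvg (W' ω) f 0) P :=
    Integrable.of_bound (hG.mono hle le_rfl).aestronglyMeasurable B
      (ae_of_all _ fun ω => abs_gaussAvg_le _ hB _)
  have hWW' : ∀ᵐ ω ∂P, W' ω = W ω := hX.posSemidef.mono fun ω h => if_pos h
  have hmono : (fun ω => gaussAvg (W' ω) f 0) ≤ᵐ[P] P⟦X ⁻¹' E | 𝒢⟧ := by
    filter_upwards [hX.condLaw E hE, hWW'] with ω h₁ h₂
    rw [h₁, h₂]
    exact hfE _
  -- The Gaussian average is a function of `W`, so conditioning on `sigmaOf W` leaves it unchanged;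
  -- the tower property then reduces the right side from `𝒢` to `sigmaOf W`.
  have h₁ := condExp_mono (m := sigmaOf W) hGi integrable_condExp hmono
  rw [condExp_of_stronglyMeasurable hle hG.stronglyMeasurable hGi] at h₁
  have h₂ := condExp_condExp_of_le (μ := P) (f := (X ⁻¹' E).indicator fun _ => (1 : ℝ))
    hW𝒢 hX.le
  filter_upwards [h₁, h₂, hWW'] with ω a b c
  rw [← c, ← b]
  exact a

/-- The real-valued bound implies the bound with `errorTerm`. -/
lemma ofReal_le_add_errorTerm {C l a g p α Δ T δ K₂ K₃ : ℝ} {τ : ℝ≥0∞} (hpg : g ≤ p)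
    (hp : 0 ≤ p) (hα : 0 ≤ α) (hΔ : 0 ≤ Δ) (hT : 0 ≤ T) (hl : l = Real.log d) (hlpos : 0 ≤ l)
    (hδ : 0 < δ) (hC : 0 ≤ C) (hτ : τ = ENNReal.ofReal T) (hK₂ : 2 * K₂ ≤ C * l / δ ^ 2)
    (hK₃ : K₃ ≤ C * l ^ 2 / δ ^ 3) (h : a ≤ g + α + 2 * K₂ * Δ + K₃ * T) :
    ENNReal.ofReal a ≤ ENNReal.ofReal p + errorTerm C d α Δ τ δ := by
  subst hl
  have h₁ := mul_le_mul_of_nonneg_right hK₂ hΔ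
  have h₂ := mul_le_mul_of_nonneg_right hK₃ hT
  have n₁ : 0 ≤ C * Real.log d / δ ^ 2 * Δ := by positivity
  have n₂ : 0 ≤ C * Real.log d ^ 2 / δ ^ 3 := by positivity
  rw [errorTerm, hτ, ← ENNReal.ofReal_mul n₂, ← ENNReal.ofReal_add (by positivity) n₁,
    ← ENNReal.ofReal_add (by positivity) (by positivity), ← ENNReal.ofReal_add hp (by positivity)]
  exact ENNReal.ofReal_le_ofReal (by linarith)

end

end

end MaxCLT

/-! ### The theorem. -/

theorem theorem2 :
    ∃ C : ℝ, 0 < C ∧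
      ∀ (d n : ℕ) (_ : 2 ≤ d)
        (Ω : Type*) (mΩ : MeasurableSpace Ω) (P : Measure Ω) (_ : IsProbabilityMeasure P)
        -- the martingale
        (ℱ : Filtration (Fin (n + 1)) mΩ) (M : Fin (n + 1) → Ω → Fin d → ℝ)
        (_ : MaxCLT.IsMartingaleFromZero P ℱ M)
        -- the Gaussian noise and the square roots that define `η_t`
        (N : Fin n → Ω → Fin d → ℝ)
        (_ : MaxCLT.IsStdGaussianNoise (ℱ (Fin.last n)) P N)
        (S : Fin n → Ω → Matrix (Fin d) (Fin d) ℝ) (_ : MaxCLT.IsSqrtCondCov P ℱ M S)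
        -- the assumption on the quadratic variation
        (V Vδ : Matrix (Fin d) (Fin d) ℝ) (_ : V.PosSemidef) (_ : Vδ.PosSemidef)
        (α : ℝ)
        (_ : 1 - α ≤ P.real {ω | (V + Vδ - MaxCLT.quadVar P ℱ M ω).PosSemidef})
        (δ : ℝ) (_ : 0 < δ) (A : Set ℝ) (_ : MeasurableSet A),
        -- comparison with the Gaussian vector `H ∼ N(0, V)`
        (∀ (Ω' : Type*) (mΩ' : MeasurableSpace Ω') (P' : Measure Ω') (_ : IsProbabilityMeasure P')
            (H : Ω' → EuclideanSpace ℝ (Fin d)) (_ : HasLaw H (multivariateGaussian 0 V) P'),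
            P {ω | MaxCLT.maxCoord (∑ t, MaxCLT.increment M t ω) ∈ A} ≤
              P' {ω' | MaxCLT.maxCoord (fun j => H ω' j) ∈ Metric.cthickening (C * δ) A}
              + MaxCLT.errorTerm C d α (MaxCLT.deltaN P ℱ M V Vδ)
                  (MaxCLT.thirdMoments P (MaxCLT.increment M) (MaxCLT.gaussIncrement S N)) δ) ∧
        -- comparison with the bootstrap vector `Hn`, Gaussian with covariance `W` conditionally
        (∀ (𝒢 : MeasurableSpace Ω) (W : Ω → Matrix (Fin d) (Fin d) ℝ)
            (Hn : Ω → EuclideanSpace ℝ (Fin d)) (_ : MaxCLT.IsCondGaussian 𝒢 P W Hn),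
            ∀ᵐ ω ∂P,
              P {ω' | MaxCLT.maxCoord (∑ t, MaxCLT.increment M t ω') ∈ A} ≤
                ENNReal.ofReal
                  ((P⟦{ω' | MaxCLT.maxCoord (fun j => Hn ω' j) ∈ Metric.cthickening (C * δ) A}
                    | MaxCLT.sigmaOf W⟧) ω)
                + ENNReal.ofReal (C * Real.log d / δ ^ 2 * MaxCLT.entryNorm (V - W ω))
                + MaxCLT.errorTerm C d α (MaxCLT.deltaN P ℱ M V Vδ)
                    (MaxCLT.thirdMoments P (MaxCLT.increment M) (MaxCLT.gaussIncrement S N)) δ) := by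
  -- The constant has to dominate `9` (enlargement of `A`), `2 * 3` (covariance term) and `46`
  -- (third moments).
  refine ⟨50, by norm_num, ?_⟩
  intro d n hd Ω mΩ P hP ℱ M hM N hN S hS V Vδ hV hVδ α hα δ hδ A hA
  -- The distance `Metric.infDist` to the empty set is `0` by convention, so the cutoff would be `1`
  -- everywhere; for `A = ∅` the left side is `0` anyway.
  rcases A.eq_empty_or_nonempty with rfl | hAne
  · simp
  have hl := MaxCLT.log_natCast_ge_half hd
  have hl0 : 0 < Real.log d := by linarith
  set τ := MaxCLT.thirdMoments P (MaxCLT.increment M) (MaxCLT.gaussIncrement S N)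
  by_cases hτ : τ = ∞
  · have hpos : 0 < 50 * Real.log d ^ 2 / δ ^ 3 := by positivity
    have : MaxCLT.errorTerm 50 d α (MaxCLT.deltaN P ℱ M V Vδ) τ δ = ∞ := by
      rw [MaxCLT.errorTerm, hτ, ENNReal.mul_top (by simpa using hpos), add_top]
    simp [this]
  obtain ⟨hξ3, hη3, hτeq⟩ := MaxCLT.thirdMoments_eq_ofReal
    (fun t => (hM.measurable_increment t).mono (ℱ.le _) le_rfl)
    (hS.measurable_gaussIncrement hN.measurable) hτ
  obtain ⟨f, f₁, f₂, hf, hf0, hf1, hfA, hfT⟩ := MaxCLT.exists_hasTaylor_cutoff hd hδ hAne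
  obtain ⟨B, hB⟩ := hf.bdd
  have hT := (Metric.isClosed_cthickening (δ := 50 * δ) (E := A)).measurableSet
  have hfT' : ∀ x, MaxCLT.maxCoord x ∉ Metric.cthickening (50 * δ) A → f x = 0 := fun x hx =>
    hfT x fun h => hx (Metric.cthickening_mono (by linarith) A h)
  have hE := MaxCLT.measurableSet_maxCoord_mem (d := d) hT
  have hfE := MaxCLT.gaussAvg_le_multivariateGaussian_real hf.cont hf1 hT hfT' hB
  set E : Set (EuclideanSpace ℝ (Fin d)) :=
    {y | MaxCLT.maxCoord (fun j => y j) ∈ Metric.cthickening (50 * δ) A}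
  have main := hf.measureReal_maxCoord_le (by positivity) hf0 hA hfA hM hS hN hξ3 hη3 hV hVδ
  set T := ∑ t, (∫ ω, ‖MaxCLT.increment M t ω‖ ^ 3 ∂P +
    ∫ ω, ‖MaxCLT.gaussIncrement S N t ω‖ ^ 3 ∂P)
  have hT0 : 0 ≤ T := Finset.sum_nonneg fun t _ => add_nonneg
    (integral_nonneg fun ω => by positivity) (integral_nonneg fun ω => by positivity)
  have hα0 : 0 ≤ α := by
    have : P.real {ω | (V + Vδ - MaxCLT.quadVar P ℱ M ω).PosSemidef} ≤ 1 := measureReal_le_one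
    linarith
  have hΔ := MaxCLT.deltaN_nonneg (P := P) (ℱ := ℱ) (M := M) V Vδ
  have k₂ : 2 * (3 * Real.log d / δ ^ 2) ≤ 50 * Real.log d / δ ^ 2 := by
    rw [← mul_div_assoc]
    exact div_le_div_of_nonneg_right (by linarith) (by positivity)
  have k₃ : 46 * Real.log d ^ 2 / δ ^ 3 ≤ 50 * Real.log d ^ 2 / δ ^ 3 :=
    div_le_div_of_nonneg_right (by nlinarith) (by positivity)
  -- Both claims use this: `p` is the Gaussian probability in the first, and the conditional
  -- probability plus the cost of replacing `V` by `W ω` in the second.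
  have bound : ∀ {p : ℝ}, 0 ≤ p → MaxCLT.gaussAvg V f 0 ≤ p →
      P {ω | MaxCLT.maxCoord (∑ t, MaxCLT.increment M t ω) ∈ A} ≤ ENNReal.ofReal p +
        MaxCLT.errorTerm 50 d α (MaxCLT.deltaN P ℱ M V Vδ) τ δ := fun hp hgp => by
    rw [← ofReal_measureReal]
    exact MaxCLT.ofReal_le_add_errorTerm hgp hp hα0 hΔ hT0 rfl hl0.le hδ (by norm_num) hτeq k₂ k₃
      (by linarith)
  constructor
  · intro Ω' mΩ' P' hP' H hH
    have hPH : P' {ω' | MaxCLT.maxCoord (fun j => H ω' j) ∈ Metric.cthickening (50 * δ) A} =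
        ENNReal.ofReal ((multivariateGaussian 0 V).real E) := by
      rw [ofReal_measureReal, ← hH.map_eq, Measure.map_apply_of_aemeasurable hH.aemeasurable hE]
      rfl
    rw [hPH]
    exact bound measureReal_nonneg (hfE V)
  · intro 𝒢 W Hn hHn
    filter_upwards [hHn.gaussAvg_le_condExp hf.cont hB hE hfE, hHn.posSemidef] with ω h₁ h₂
    change _ ≤ (P⟦{ω' | MaxCLT.maxCoord (fun j => Hn ω' j) ∈ Metric.cthickening (50 * δ) A} |
      MaxCLT.sigmaOf W⟧) ω at h₁
    have hg0 := MaxCLT.gaussAvg_nonneg hf0 (W ω) 0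
    have hcmp := (abs_le.1 (hf.abs_gaussAvg_sub_gaussAvg_le hV h₂ 0)).2
    have hn := MaxCLT.entryNorm_nonneg (V - W ω)
    have hk : 3 * Real.log d / δ ^ 2 * MaxCLT.entryNorm (V - W ω) ≤
        50 * Real.log d / δ ^ 2 * MaxCLT.entryNorm (V - W ω) :=
      mul_le_mul_of_nonneg_right (div_le_div_of_nonneg_right (by linarith) (by positivity)) hn
    have hn' : 0 ≤ 50 * Real.log d / δ ^ 2 * MaxCLT.entryNorm (V - W ω) := by positivity
    have hp := hg0.trans h₁
    rw [← ENNReal.ofReal_add (by exact hp) hn']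
    exact bound (add_nonneg hp hn') (by linarith)
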